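/- **Conventions.** A quantaloid is a (possibly large) category whose hom-sets are complete lattices and whose composition preserves arbitrary joins in each variable; it is small if its objects form a set. Write $w\swarrow u$ and $v\searrow w$ for the implications, so $v\circ u\le w\iff v\le w\swarrow u\iff u\le v\searrow w$ for $u:p\to q$, $v:q\to r$, $w:p\to r$. Two quantaloids are equivalent ($\simeq$) if there is a functor between them that preserves all joins of arrows and is an equivalence of categories. The opposite quantaloid reverses arrows and keeps their order. A congruence is a family of equivalence relations on the hom-sets compatible with composition and arbitrary joins; its quotient is again a quantaloid (with the same objects, and compositions and joins induced from representatives). A quantaloid $\mathcal Q$ is Girard if it has arrows $d_q:q\to q$, one for each object $q$, with $d_p\swarrow u=u\searrow d_q$ and $(d_p\swarrow u)\searrow d_p=u=d_q\swarrow(u\searrow d_q)$ for all $u:p\to q$. For a quantaloid $\mathcal C$: * $\mathbf D(\mathcal C)$ has as objects the arrows of $\mathcal C$. Its arrows $u\to v$ are the pairs $(s:\mathrm{dom}\,u\to\mathrm{dom}\,v,\ t:\mathrm{cod}\,u\to\mathrm{cod}\,v)$ with $v\circ s=t\circ u$, ordered componentwise, modulo the congruence $(s,t)\sim(s',t')\iff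 v\circ s=v\circ s'$. * $\mathbf B(\mathcal C)$ has as objects the arrows of $\mathcal C$. Its arrows $u\to v$ are the pairs $(s:\mathrm{dom}\,u\to\mathrm{dom}\,v,\ t:\mathrm{cod}\,u\to\mathrm{cod}\,v)$ with $u\swarrow s=t\searrow v$, ordered componentwise, modulo the congruence $(s,t)\sim(s',t')\iff u\swarrow s=u\swarrow s'$. Let $\mathcal Q$ be a small quantaloid. A $\mathcal Q$-category is a set $X$ with a type map $|\cdot|:X\to\mathrm{ob}\,\mathcal Q$ and arrows $X(x,y):|x|\to|y|$ such that $1_{|x|}\le X(x,x)$ and $X(y,z)\circ X(x,y)\le X(x,z)$. Its elements of the same type are preordered by $x\le y\iff 1_{|x|}\le X(x,y)$, and $X$ is separated if $x\le y\le x$ implies $x=y$. A $\mathcal Q$-functor $f:X\to Y$ is a type-preserving map with $X(x,y)\le Y(fx,fy)$; $\mathcal Q$-functors are ordered pointwise, and $f\dashv g$ means $Y(fx,y)=X(x,gy)$ for all $x,y$. A $\mathcal Q$-distributor $\phi:X\nrightarrow Y$ is a family of arrows $\phi(x,y):|x|\to|y|$ with $Y(y,y')\circ\phi(x,y)\circ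 X(x',x)\le\phi(x',y')$. The quantaloid $\mathcal Q\text{-}\mathbf{Dist}$ has $\mathcal Q$-categories as objects and $\mathcal Q$-distributors as arrows, ordered pointwise, with composition $(\psi\circ\phi)(x,z)=\bigvee_y\psi(y,z)\circ\phi(x,y)$ and the hom of $X$ as identity on $X$. Let $\{q\}$ be the $\mathcal Q$-category with one element, of type $q$ and with hom $1_q$. The presheaf $\mathcal Q$-category $\mathsf PX$ has as elements of type $q$ the distributors $\mu:X\nrightarrow\{q\}$, and $\mathsf PX(\mu,\mu')=\mu'\swarrow\mu$. A distributor $\zeta:X\nrightarrow Y$ induces the $\mathcal Q$-functor $\zeta^*:\mathsf PY\to\mathsf PX$, $\lambda\mapsto\lambda\circ\zeta$. * $(\mathcal Q\text{-}\mathbf{IntDist})_{\mathsf o}$: a $\mathcal Q$-interior space is a $\mathcal Q$-category $X$ with a $\mathcal Q$-functor $\sigma:\mathsf PX\to\mathsf PX$ such that $\sigma\le 1$ and $\sigma\sigma=\sigma$. A distributor $\zeta:X\nrightarrow Y$ between interior spaces $(X,\sigma)$, $(Y,\tau)$ is continuous if $\zeta^*\tau\le\sigma\zeta^*$. Interior spaces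 and continuous distributors form the quantaloid $\mathcal Q\text{-}\mathbf{IntDist}$, with order, composition and identities as in $\mathcal Q\text{-}\mathbf{Dist}$; $(\mathcal Q\text{-}\mathbf{IntDist})_{\mathsf o}$ is its quotient by the congruence $\zeta\sim\zeta'\iff\zeta^*\tau=\zeta'^*\tau$. * $\mathcal Q\text{-}\mathbf{ClsCloDist}$: a $\mathcal Q$-closure space is a $\mathcal Q$-category $X$ with a $\mathcal Q$-functor $c:\mathsf PX\to\mathsf PX$ such that $1\le c$ and $cc=c$. A distributor $\zeta:X\nrightarrow Y$ between closure spaces $(X,c)$, $(Y,d)$ is continuous if $\zeta^*d\le c\zeta^*$, and closed if $c(\zeta(-,y))=\zeta(-,y)$ for all $y\in Y$; its closure $\mathrm{cl}\,\zeta:X\nrightarrow Y$ is given by $(\mathrm{cl}\,\zeta)(-,y)=c(\zeta(-,y))$. The objects of $\mathcal Q\text{-}\mathbf{ClsCloDist}$ are the closure spaces and its arrows are the closed continuous distributors, ordered pointwise; composites, identities and joins are the closures of those in $\mathcal Q\text{-}\mathbf{Dist}$. * $\mathcal Q\text{-}\mathbf{Sup}$: its objects are the separated $\mathcal Q$-categories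 $X$ that are complete, i.e. whose Yoneda embedding $X\to\mathsf PX$, $x\mapsto X(-,x)$, has a left adjoint; its arrows are the $\mathcal Q$-functors that are left adjoints, ordered pointwise. **Theorem.** If $\mathcal Q$ is a small Girard quantaloid, then there are equivalences of quantaloids $$\mathbf D(\mathcal Q\text{-}\mathbf{Dist})\simeq\mathbf B(\mathcal Q\text{-}\mathbf{Dist})\simeq(\mathcal Q\text{-}\mathbf{IntDist})_{\mathsf o}\simeq\mathcal Q\text{-}\mathbf{ClsCloDist}\simeq(\mathcal Q\text{-}\mathbf{Sup})^{\mathrm{op}}.$$ -/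

import Mathlib

open CategoryTheory

universe u v w w'

namespace Quantaloids

/-- A (possibly large) quantaloid: a category whose hom-sets are complete lattices and whose
composition preserves joins on both sides.  Composition is written in diagrammatic order, so that
`u ≫ v` is the composite `v ∘ u`. -/
class Quantaloid (C : Type w) [Category.{v} C] where
  [homLattice : ∀ p q : C, CompleteLattice (p ⟶ q)]
  sSup_comp : ∀ {p q r : C} (S : Set (p ⟶ q)) (g : q ⟶ r),
    sSup S ≫ g = sSup ((fun f => f ≫ g) '' S)
  comp_sSup : ∀ {p q r : C} (f : p ⟶ q) (S : Set (q ⟶ r)),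
    f ≫ sSup S = sSup ((fun g => f ≫ g) '' S)

attribute [reducible, instance] Quantaloid.homLattice

section General

variable {C : Type w} [Category.{v} C] [Quantaloid C]

theorem iSup_comp {ι : Sort*} {p q r : C} (f : ι → (p ⟶ q)) (g : q ⟶ r) :
    (⨆ i, f i) ≫ g = ⨆ i, f i ≫ g := by
  rw [iSup, Quantaloid.sSup_comp, iSup, ← Set.range_comp]; rfl

theorem comp_iSup {ι : Sort*} {p q r : C} (f : p ⟶ q) (g : ι → (q ⟶ r)) :
    f ≫ (⨆ i, g i) = ⨆ i, f ≫ g i := by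
  rw [iSup, Quantaloid.comp_sSup, iSup, ← Set.range_comp]; rfl

theorem comp_le_comp {p q r : C} {f f' : p ⟶ q} {g g' : q ⟶ r} (hf : f ≤ f') (hg : g ≤ g') :
    f ≫ g ≤ f' ≫ g' := by
  have h1 : f ≫ g ≤ f' ≫ g := by
    have := Quantaloid.sSup_comp {f, f'} g
    rw [sSup_pair, sup_eq_right.2 hf] at this
    rw [this]; exact le_sSup ⟨f, by simp, rfl⟩
  have h2 : f' ≫ g ≤ f' ≫ g' := by
    have := Quantaloid.comp_sSup f' {g, g'}
    rw [sSup_pair, sup_eq_right.2 hg] at this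
    rw [this]; exact le_sSup ⟨g, by simp, rfl⟩
  exact h1.trans h2

/-- Left implication `w ↙ u`, the right adjoint of precomposition `- ∘ u`. -/
def lda {p q r : C} (w : p ⟶ r) (u : p ⟶ q) : q ⟶ r := sSup {v | u ≫ v ≤ w}

/-- Right implication `v ↘ w`, the right adjoint of postcomposition `v ∘ -`. -/
def rda {p q r : C} (v : q ⟶ r) (w : p ⟶ r) : p ⟶ q := sSup {u | u ≫ v ≤ w}

theorem le_lda_iff {p q r : C} {w : p ⟶ r} {u : p ⟶ q} {v : q ⟶ r} :
    v ≤ lda w u ↔ u ≫ v ≤ w := by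
  refine ⟨fun h => (comp_le_comp le_rfl h).trans ?_, fun h => le_sSup h⟩
  rw [lda, Quantaloid.comp_sSup]
  exact sSup_le (by rintro _ ⟨v, hv, rfl⟩; exact hv)

theorem le_rda_iff {p q r : C} {v : q ⟶ r} {w : p ⟶ r} {u : p ⟶ q} :
    u ≤ rda v w ↔ u ≫ v ≤ w := by
  refine ⟨fun h => (comp_le_comp h le_rfl).trans ?_, fun h => le_sSup h⟩
  rw [rda, Quantaloid.sSup_comp]
  exact sSup_le (by rintro _ ⟨v, hv, rfl⟩; exact hv)

theorem lda_comp {p q r s : C} (w : p ⟶ s) (u : p ⟶ q) (u' : q ⟶ r) :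
    lda w (u ≫ u') = lda (lda w u) u' :=
  eq_of_forall_le_iff fun v => by simp only [le_lda_iff, Category.assoc]

theorem comp_rda {p q r s : C} (w : p ⟶ s) (v : q ⟶ r) (v' : r ⟶ s) :
    rda (v ≫ v') w = rda v (rda v' w) :=
  eq_of_forall_le_iff fun u => by simp only [le_rda_iff, Category.assoc]

theorem rda_lda {p q r s : C} (w : p ⟶ s) (u : p ⟶ q) (v : r ⟶ s) :
    lda (rda v w) u = rda v (lda w u) :=
  eq_of_forall_le_iff fun u => by simp only [le_rda_iff, le_lda_iff, Category.assoc]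

end General

/-- A quantaloid is Girard if it admits a cyclic dualizing family of arrows. -/
def IsGirard (C : Type w) [Category.{v} C] [Quantaloid C] : Prop :=
  ∃ d : ∀ q : C, q ⟶ q,
    (∀ {p q : C} (u : p ⟶ q), lda (d p) u = rda u (d q)) ∧
    (∀ {p q : C} (u : p ⟶ q), rda (lda (d p) u) (d p) = u ∧ lda (d q) (rda u (d q)) = u)

/-- A functor between quantaloids is a homomorphism if it preserves all joins of arrows. -/
def IsQuantaloidHom {C : Type w} [Category.{v} C] [Quantaloid C]
    {D : Type w'} [Category.{v} D] [Quantaloid D] (F : C ⥤ D) : Prop :=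
  ∀ {p q : C} (S : Set (p ⟶ q)), F.map (sSup S) = sSup ((fun f => F.map f) '' S)

/-- Two quantaloids are equivalent if there is a homomorphism between them whose underlying
functor is an equivalence of categories. -/
def QuantaloidEquivalent (C : Type w) [Category.{v} C] [Quantaloid C]
    (D : Type w') [Category.{v} D] [Quantaloid D] : Prop :=
  ∃ F : C ⥤ D, IsQuantaloidHom F ∧ F.IsEquivalence

/-! ### Opposite quantaloids -/

section Opposite

variable {C : Type w} [Category.{v} C] [Quantaloid C]

instance opHomPartialOrder (X Y : Cᵒᵖ) : PartialOrder (X ⟶ Y) :=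
  PartialOrder.lift (fun f : X ⟶ Y => f.unop) (fun _ _ h => Quiver.Hom.unop_inj h)

instance opHomSupSet (X Y : Cᵒᵖ) : SupSet (X ⟶ Y) where
  sSup S := (sSup ((fun f : X ⟶ Y => f.unop) '' S)).op

/-- The opposite quantaloid: arrows are reversed, the order of arrows is kept. -/
instance opQuantaloid : Quantaloid Cᵒᵖ where
  homLattice X Y := completeLatticeOfSup (X ⟶ Y) fun S =>
    ⟨fun f hf => show f.unop ≤ sSup ((fun g : X ⟶ Y => g.unop) '' S) from
      le_sSup ⟨f, hf, rfl⟩,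
     fun f hf => show sSup ((fun g : X ⟶ Y => g.unop) '' S) ≤ f.unop from
      sSup_le (by rintro _ ⟨g, hg, rfl⟩; exact hf hg)⟩
  sSup_comp S g := by
    apply Quiver.Hom.unop_inj
    change g.unop ≫ sSup _ = sSup _
    rw [Quantaloid.comp_sSup, Set.image_image, Set.image_image]; rfl
  comp_sSup f S := by
    apply Quiver.Hom.unop_inj
    change sSup _ ≫ f.unop = sSup _
    rw [Quantaloid.sSup_comp, Set.image_image, Set.image_image]; rfl

end Opposite

/-! ### Congruences and quotient quantaloids -/

/-- A congruence on a quantaloid: equivalence relations on the hom-sets that are compatible with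
composition and with arbitrary joins. -/
structure Congruence (C : Type w) [Category.{v} C] [Quantaloid C] where
  rel : ∀ p q : C, Setoid (p ⟶ q)
  comp : ∀ {p q r : C} {u u' : p ⟶ q} {v v' : q ⟶ r},
    (rel p q).r u u' → (rel q r).r v v' → (rel p r).r (u ≫ v) (u' ≫ v')
  iSup : ∀ {p q : C} {ι : Type v} (u u' : ι → (p ⟶ q)),
    (∀ i, (rel p q).r (u i) (u' i)) → (rel p q).r (⨆ i, u i) (⨆ i, u' i)

namespace Congruence

variable {C : Type w} [Category.{v} C] [Quantaloid C] (θ : Congruence C)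

/-- The largest arrow equivalent to a given one. -/
def top {p q : C} (f : p ⟶ q) : p ⟶ q := ⨆ g : {g : p ⟶ q // (θ.rel p q).r g f}, g.1

theorem rel_top {p q : C} (f : p ⟶ q) : (θ.rel p q).r (θ.top f) f := by
  have := θ.iSup (fun g : {g : p ⟶ q // (θ.rel p q).r g f} => g.1) (fun _ => f) (fun g => g.2)
  have hne : Nonempty {g : p ⟶ q // (θ.rel p q).r g f} := ⟨⟨f, (θ.rel p q).refl f⟩⟩
  rwa [iSup_const] at this

theorem le_top_of_rel {p q : C} {f g : p ⟶ q} (h : (θ.rel p q).r g f) : g ≤ θ.top f :=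
  le_iSup (fun g : {g : p ⟶ q // (θ.rel p q).r g f} => g.1) ⟨g, h⟩

theorem le_top {p q : C} (f : p ⟶ q) : f ≤ θ.top f := θ.le_top_of_rel ((θ.rel p q).refl f)

theorem rel_sup {p q : C} {f f' g g' : p ⟶ q} (hf : (θ.rel p q).r f f')
    (hg : (θ.rel p q).r g g') : (θ.rel p q).r (f ⊔ g) (f' ⊔ g') := by
  have := θ.iSup (fun b : ULift.{v} Bool => bif b.down then f else g)
    (fun b => bif b.down then f' else g') (by rintro ⟨_ | _⟩ <;> assumption)
  simpa [iSup_ulift, iSup_bool_eq] using this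

theorem top_eq_of_rel {p q : C} {f g : p ⟶ q} (h : (θ.rel p q).r f g) : θ.top f = θ.top g :=
  le_antisymm (θ.le_top_of_rel ((θ.rel p q).trans (θ.rel_top f) h))
    (θ.le_top_of_rel ((θ.rel p q).trans (θ.rel_top g) ((θ.rel p q).symm h)))

theorem le_top_iff {p q : C} {f g : p ⟶ q} : f ≤ θ.top g ↔ (θ.rel p q).r (f ⊔ g) g := by
  refine ⟨fun h => ?_, fun h => le_sup_left.trans (θ.le_top_of_rel h)⟩
  have := θ.rel_sup ((θ.rel p q).refl f) (θ.rel_top g)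
  rw [sup_eq_right.2 h] at this
  exact (θ.rel p q).trans ((θ.rel p q).symm this) (θ.rel_top g)

theorem top_le_top_iff {p q : C} {f g : p ⟶ q} : θ.top f ≤ θ.top g ↔ f ≤ θ.top g := by
  refine ⟨(θ.le_top f).trans, fun h => ?_⟩
  rw [θ.le_top_iff] at h ⊢
  exact (θ.rel p q).trans (θ.rel_sup (θ.rel_top f) ((θ.rel p q).refl g)) h

/-- The quotient quantaloid `C/θ`; it has the same objects as `C`. -/
structure Quot (θ : Congruence C) where
  of ::
  as : C

instance quotCategory : Category.{v} θ.Quot where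
  Hom X Y := Quotient (θ.rel X.as Y.as)
  id X := Quotient.mk _ (𝟙 X.as)
  comp f g := Quotient.map₂ (fun u v => u ≫ v) (fun _ _ h _ _ h' => θ.comp h h') f g
  id_comp := by rintro X Y ⟨f⟩; exact congrArg (Quotient.mk _) (Category.id_comp f)
  comp_id := by rintro X Y ⟨f⟩; exact congrArg (Quotient.mk _) (Category.comp_id f)
  assoc := by rintro X Y Z W ⟨f⟩ ⟨g⟩ ⟨h⟩; exact congrArg (Quotient.mk _) (Category.assoc f g h)

/-- The class of an arrow in the quotient quantaloid. -/
def cls {X Y : θ.Quot} (f : X.as ⟶ Y.as) : X ⟶ Y := Quotient.mk _ f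

/-- The largest representative of an arrow of the quotient quantaloid. -/
def rep {X Y : θ.Quot} (a : X ⟶ Y) : X.as ⟶ Y.as :=
  Quotient.lift (fun f => θ.top f) (fun _ _ h => θ.top_eq_of_rel h) a

theorem cls_rep {X Y : θ.Quot} (a : X ⟶ Y) : θ.cls (θ.rep a) = a := by
  obtain ⟨f⟩ := a; exact Quotient.sound (θ.rel_top f)

theorem cls_comp {X Y Z : θ.Quot} (f : X.as ⟶ Y.as) (g : Y.as ⟶ Z.as) :
    (θ.cls (f ≫ g) : X ⟶ Z) = (θ.cls f : X ⟶ Y) ≫ (θ.cls g : Y ⟶ Z) := rfl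

/-- The order of the quotient compares largest representatives; equivalently (see
`cls_le_cls_iff`), `[f] ≤ [g]` if and only if `[f ⊔ g] = [g]`. -/
instance quotPartialOrder (X Y : θ.Quot) : PartialOrder (X ⟶ Y) :=
  PartialOrder.lift θ.rep (Function.LeftInverse.injective θ.cls_rep)

theorem cls_le_cls_iff {X Y : θ.Quot} {f g : X.as ⟶ Y.as} :
    (θ.cls f : X ⟶ Y) ≤ θ.cls g ↔ (θ.cls (f ⊔ g) : X ⟶ Y) = θ.cls g := by
  refine Iff.trans (b := (θ.rel X.as Y.as).r (f ⊔ g) g) ?_ ⟨fun h => Quotient.sound h, fun h => Quotient.exact h⟩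
  rw [← θ.le_top_iff, ← θ.top_le_top_iff]; rfl

instance quotSupSet (X Y : θ.Quot) : SupSet (X ⟶ Y) where
  sSup S := θ.cls (sSup (θ.rep '' S))

instance quotLattice (X Y : θ.Quot) : CompleteLattice (X ⟶ Y) :=
  completeLatticeOfSup (X ⟶ Y) fun S =>
    ⟨fun a ha => show θ.rep a ≤ θ.top (sSup (θ.rep '' S)) from
      (le_sSup (Set.mem_image_of_mem θ.rep ha)).trans (θ.le_top _),
     fun a ha => show θ.top (sSup (θ.rep '' S)) ≤ θ.rep a by
      have h : sSup (θ.rep '' S) ≤ θ.rep a :=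
        sSup_le (by rintro _ ⟨b, hb, rfl⟩; exact ha hb)
      obtain ⟨f⟩ := a
      exact θ.top_le_top_iff.2 h⟩

/-- The quotient map preserves joins of arrows. -/
theorem cls_sSup {X Y : θ.Quot} (S : Set (X.as ⟶ Y.as)) :
    (θ.cls (sSup S) : X ⟶ Y) = sSup ((fun f => θ.cls f) '' S) := by
  refine (IsLUB.sSup_eq ⟨?_, ?_⟩).symm
  · rintro _ ⟨f, hf, rfl⟩
    exact θ.top_le_top_iff.2 ((le_sSup hf).trans (θ.le_top _))
  · rintro ⟨g⟩ hg
    refine θ.top_le_top_iff.2 (sSup_le fun f hf => ?_)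
    exact θ.top_le_top_iff.1 (hg ⟨f, hf, rfl⟩)

instance quotQuantaloid : Quantaloid θ.Quot where
  sSup_comp {X Y Z} S g := by
    obtain ⟨T, rfl⟩ : ∃ T : Set (X.as ⟶ Y.as), S = (fun f => θ.cls f) '' T :=
      ⟨θ.rep '' S, by simp [Set.image_image, θ.cls_rep]⟩
    obtain ⟨g', rfl⟩ : ∃ g' : Y.as ⟶ Z.as, g = θ.cls g' := ⟨_, (θ.cls_rep g).symm⟩
    rw [← θ.cls_sSup, ← θ.cls_comp, Quantaloid.sSup_comp, θ.cls_sSup, Set.image_image,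
      Set.image_image]
    rfl
  comp_sSup {X Y Z} f S := by
    obtain ⟨T, rfl⟩ : ∃ T : Set (Y.as ⟶ Z.as), S = (fun f => θ.cls f) '' T :=
      ⟨θ.rep '' S, by simp [Set.image_image, θ.cls_rep]⟩
    obtain ⟨f', rfl⟩ : ∃ f' : X.as ⟶ Y.as, f = θ.cls f' := ⟨_, (θ.cls_rep f).symm⟩
    rw [← θ.cls_sSup, ← θ.cls_comp, Quantaloid.comp_sSup, θ.cls_sSup, Set.image_image,
      Set.image_image]
    rfl

end Congruence

/-! ### Diagonals -/

section Diagonals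

variable {C : Type w} [Category.{v} C] [Quantaloid C]

instance arrPartialOrder (u v : Arrow C) : PartialOrder (u ⟶ v) :=
  PartialOrder.lift (fun f => (f.left, f.right)) (fun f g h => by
    obtain ⟨h1, h2⟩ := Prod.mk.inj h
    exact Arrow.hom_ext _ _ h1 h2)

instance arrSupSet (u v : Arrow C) : SupSet (u ⟶ v) where
  sSup S := Arrow.homMk (sSup ((fun f => f.left) '' S)) (sSup ((fun f => f.right) '' S)) (by
    rw [Quantaloid.sSup_comp, Quantaloid.comp_sSup, Set.image_image, Set.image_image]
    simp)

/-- The arrow category `Arr(C)` (whose arrows `u ⟶ v` are the pairs `(s, t)` with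
`v ∘ s = t ∘ u`) is a quantaloid with the componentwise order. -/
instance arrQuantaloid : Quantaloid (Arrow C) where
  homLattice u v := completeLatticeOfSup (u ⟶ v) fun S =>
    ⟨fun f hf => show (f.left, f.right) ≤ (sSup _, sSup _) from
      ⟨le_sSup ⟨f, hf, rfl⟩, le_sSup ⟨f, hf, rfl⟩⟩,
     fun f hf => show (sSup _, sSup _) ≤ (f.left, f.right) from
      ⟨sSup_le (by rintro _ ⟨g, hg, rfl⟩; exact (hf hg).1),
       sSup_le (by rintro _ ⟨g, hg, rfl⟩; exact (hf hg).2)⟩⟩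
  sSup_comp S g := by
    apply Arrow.hom_ext
    · change sSup _ ≫ g.left = sSup _
      rw [Quantaloid.sSup_comp, Set.image_image, Set.image_image]; rfl
    · change sSup _ ≫ g.right = sSup _
      rw [Quantaloid.sSup_comp, Set.image_image, Set.image_image]; rfl
  comp_sSup f S := by
    apply Arrow.hom_ext
    · change f.left ≫ sSup _ = sSup _
      rw [Quantaloid.comp_sSup, Set.image_image, Set.image_image]; rfl
    · change f.right ≫ sSup _ = sSup _
      rw [Quantaloid.comp_sSup, Set.image_image, Set.image_image]; rfl

variable (C) in
/-- Two arrows `(s, t), (s', t') : u ⟶ v` of `Arr(C)` are identified if they have the same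
diagonal, i.e. `v ∘ s = v ∘ s'` (equivalently `t ∘ u = t' ∘ u`, as `v ∘ s = t ∘ u` and
`v ∘ s' = t' ∘ u`). -/
def diagonalCongruence : Congruence (Arrow C) where
  rel u v :=
    { r := fun f g => f.left ≫ v.hom = g.left ≫ v.hom
      iseqv := ⟨fun _ => rfl, fun h => h.symm, fun h h' => h.trans h'⟩ }
  comp {u v w f f' g g'} h h' := by
    change (f.left ≫ g.left) ≫ w.hom = (f'.left ≫ g'.left) ≫ w.hom
    change f.left ≫ v.hom = f'.left ≫ v.hom at h
    change g.left ≫ w.hom = g'.left ≫ w.hom at h'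
    rw [Category.assoc, h', Category.assoc, ← h', Arrow.w, ← Category.assoc, h, Category.assoc]
  iSup {u v ι} f f' h := by
    change sSup _ ≫ v.hom = sSup _ ≫ v.hom
    rw [Quantaloid.sSup_comp, Quantaloid.sSup_comp]
    congr 1
    simp only [← Set.range_comp]
    exact congrArg Set.range (funext h)

variable (C) in
/-- The quantaloid `D(C)` of diagonals (the Freyd completion) of a quantaloid `C`. -/
abbrev Diag : Type (max w v) := (diagonalCongruence C).Quot

end Diagonals

/-! ### Back diagonals -/

/-- The objects of `ChuCon(C)` are the arrows of `C`. -/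
structure ChuCon (C : Type w) [Category.{v} C] where
  {dom : C}
  {cod : C}
  arr : dom ⟶ cod

section BackDiagonals

variable {C : Type w} [Category.{v} C] [Quantaloid C]

/-- A Chu connection `(s, t) : u ⟶ v`, i.e. a pair of arrows `s : dom u ⟶ dom v` and
`t : cod u ⟶ cod v` with `u ↙ s = t ↘ v`. -/
@[ext]
structure ChuCon.Hom (u v : ChuCon C) where
  fst : u.dom ⟶ v.dom
  snd : u.cod ⟶ v.cod
  w : lda u.arr fst = rda snd v.arr

instance chuConCategory : Category.{v} (ChuCon C) where
  Hom u v := ChuCon.Hom u v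
  id u := ⟨𝟙 _, 𝟙 _, eq_of_forall_le_iff fun x => by
    rw [le_lda_iff, le_rda_iff, Category.id_comp, Category.comp_id]⟩
  comp f g := ⟨f.fst ≫ g.fst, f.snd ≫ g.snd, by
    rw [lda_comp, f.w, rda_lda, g.w, comp_rda]⟩
  id_comp f := ChuCon.Hom.ext (Category.id_comp f.fst) (Category.id_comp f.snd)
  comp_id f := ChuCon.Hom.ext (Category.comp_id f.fst) (Category.comp_id f.snd)
  assoc f g h := ChuCon.Hom.ext (Category.assoc f.fst g.fst h.fst)
    (Category.assoc f.snd g.snd h.snd)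

instance chuConPartialOrder (u v : ChuCon C) : PartialOrder (u ⟶ v) :=
  PartialOrder.lift (fun f : ChuCon.Hom u v => (f.fst, f.snd)) (fun _ _ h =>
    ChuCon.Hom.ext (Prod.mk.inj h).1 (Prod.mk.inj h).2)

theorem le_lda_sSup_iff {p q r : C} {w : p ⟶ r} {S : Set (p ⟶ q)} {v : q ⟶ r} :
    v ≤ lda w (sSup S) ↔ ∀ u ∈ S, v ≤ lda w u := by
  simp only [le_lda_iff]
  rw [Quantaloid.sSup_comp]; simp

theorem le_rda_sSup_iff {p q r : C} {S : Set (q ⟶ r)} {w : p ⟶ r} {u : p ⟶ q} :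
    u ≤ rda (sSup S) w ↔ ∀ v ∈ S, u ≤ rda v w := by
  simp only [le_rda_iff]
  rw [Quantaloid.comp_sSup]; simp

instance chuConSupSet (u v : ChuCon C) : SupSet (u ⟶ v) where
  sSup S := ChuCon.Hom.mk (sSup ((fun f : ChuCon.Hom u v => f.fst) '' S))
    (sSup ((fun f : ChuCon.Hom u v => f.snd) '' S)) (eq_of_forall_le_iff fun x => by
      rw [le_lda_sSup_iff, le_rda_sSup_iff]
      simp only [Set.forall_mem_image]
      exact forall₂_congr fun f _ => by rw [ChuCon.Hom.w f])

/-- `ChuCon(C)` is a quantaloid with the componentwise order. -/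
instance chuConQuantaloid : Quantaloid (ChuCon C) where
  homLattice u v := completeLatticeOfSup (u ⟶ v) fun S =>
    ⟨fun (f : ChuCon.Hom u v) hf => show (f.fst, f.snd) ≤ (sSup _, sSup _) from
      ⟨le_sSup ⟨f, hf, rfl⟩, le_sSup ⟨f, hf, rfl⟩⟩,
     fun (f : ChuCon.Hom u v) hf => show (sSup _, sSup _) ≤ (f.fst, f.snd) from
      ⟨sSup_le (by rintro _ ⟨g, hg, rfl⟩; exact (hf hg).1),
       sSup_le (by rintro _ ⟨g, hg, rfl⟩; exact (hf hg).2)⟩⟩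
  sSup_comp {u v w} S (g : ChuCon.Hom v w) := by
    apply ChuCon.Hom.ext
    · change sSup _ ≫ g.fst = sSup _
      rw [Quantaloid.sSup_comp, Set.image_image, Set.image_image]; rfl
    · change sSup _ ≫ g.snd = sSup _
      rw [Quantaloid.sSup_comp, Set.image_image, Set.image_image]; rfl
  comp_sSup {u v w} (f : ChuCon.Hom u v) S := by
    apply ChuCon.Hom.ext
    · change f.fst ≫ sSup _ = sSup _
      rw [Quantaloid.comp_sSup, Set.image_image, Set.image_image]; rfl
    · change f.snd ≫ sSup _ = sSup _
      rw [Quantaloid.comp_sSup, Set.image_image, Set.image_image]; rfl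

variable (C) in
/-- Two Chu connections `(s, t), (s', t') : u ⟶ v` are identified if they generate the same back
diagonal, i.e. `u ↙ s = u ↙ s'` (equivalently `t ↘ v = t' ↘ v`, as `u ↙ s = t ↘ v` and
`u ↙ s' = t' ↘ v`). -/
def backDiagonalCongruence : Congruence (ChuCon C) where
  rel u v :=
    { r := fun f g => lda u.arr f.fst = lda u.arr g.fst
      iseqv := ⟨fun _ => rfl, fun h => h.symm, fun h h' => h.trans h'⟩ }
  comp {u v w f f' g g'} h h' := by
    change lda u.arr (f.fst ≫ g.fst) = lda u.arr (f'.fst ≫ g'.fst)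
    change lda u.arr f.fst = lda u.arr f'.fst at h
    change lda v.arr g.fst = lda v.arr g'.fst at h'
    rw [lda_comp, lda_comp, ← h, f.w, rda_lda, rda_lda, h']
  iSup {u v ι} f f' h := by
    change lda u.arr (sSup _) = lda u.arr (sSup _)
    refine eq_of_forall_le_iff fun x => ?_
    rw [le_lda_sSup_iff, le_lda_sSup_iff]
    simp only [Set.forall_mem_image, Set.forall_mem_range]
    exact forall_congr' fun i => by rw [show lda u.arr (f i).fst = lda u.arr (f' i).fst from h i]

variable (C) in
/-- The quantaloid `B(C)` of back diagonals of a quantaloid `C`. -/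
abbrev BackDiag : Type (max w v) := (backDiagonalCongruence C).Quot

end BackDiagonals

/-! ### Nuclei and quantaloids of fixed arrows -/

/-- A nucleus on a quantaloid: a closure operator on each hom-set, laxly compatible with
composition. -/
structure QNucleus (C : Type w) [Category.{v} C] [Quantaloid C] where
  cl : ∀ {p q : C}, (p ⟶ q) → (p ⟶ q)
  mono : ∀ {p q : C} {f g : p ⟶ q}, f ≤ g → cl f ≤ cl g
  le : ∀ {p q : C} (f : p ⟶ q), f ≤ cl f
  idem : ∀ {p q : C} (f : p ⟶ q), cl (cl f) = cl f
  comp : ∀ {p q r : C} (f : p ⟶ q) (g : q ⟶ r), cl f ≫ cl g ≤ cl (f ≫ g)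

namespace QNucleus

variable {C : Type w} [Category.{v} C] [Quantaloid C] (j : QNucleus C)

theorem cl_comp_left {p q r : C} (f : p ⟶ q) (g : q ⟶ r) : j.cl (j.cl f ≫ g) = j.cl (f ≫ g) :=
  le_antisymm
    ((j.mono ((comp_le_comp le_rfl (j.le g)).trans (j.comp f g))).trans (j.idem _).le)
    (j.mono (comp_le_comp (j.le f) le_rfl))

theorem cl_comp_right {p q r : C} (f : p ⟶ q) (g : q ⟶ r) : j.cl (f ≫ j.cl g) = j.cl (f ≫ g) :=
  le_antisymm
    ((j.mono ((comp_le_comp (j.le f) le_rfl).trans (j.comp f g))).trans (j.idem _).le)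
    (j.mono (comp_le_comp le_rfl (j.le g)))

theorem cl_sSup_cl {p q : C} (S : Set (p ⟶ q)) : j.cl (sSup (j.cl '' S)) = j.cl (sSup S) := by
  refine le_antisymm ((j.mono (sSup_le ?_)).trans (j.idem _).le)
    (j.mono (sSup_le fun f hf => (j.le f).trans (le_sSup ⟨f, hf, rfl⟩)))
  rintro _ ⟨f, hf, rfl⟩
  exact j.mono (le_sSup hf)

/-- The quantaloid of fixed arrows of a nucleus; it has the same objects as `C`, its arrows are the
arrows `f` of `C` with `cl f = f`, and identities, composites and joins are obtained by applying
`cl` to those of `C`. -/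
structure Fix (j : QNucleus C) where
  of ::
  as : C

instance fixCategory : Category.{v} j.Fix where
  Hom X Y := {f : X.as ⟶ Y.as // j.cl f = f}
  id X := ⟨j.cl (𝟙 X.as), j.idem _⟩
  comp f g := ⟨j.cl (f.1 ≫ g.1), j.idem _⟩
  id_comp f := Subtype.ext (by
    change j.cl (j.cl (𝟙 _) ≫ f.1) = f.1
    rw [cl_comp_left, Category.id_comp, f.2])
  comp_id f := Subtype.ext (by
    change j.cl (f.1 ≫ j.cl (𝟙 _)) = f.1
    rw [cl_comp_right, Category.comp_id, f.2])
  assoc f g h := Subtype.ext (by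
    change j.cl (j.cl (f.1 ≫ g.1) ≫ h.1) = j.cl (f.1 ≫ j.cl (g.1 ≫ h.1))
    rw [cl_comp_left, cl_comp_right, Category.assoc])

instance fixPartialOrder (X Y : j.Fix) : PartialOrder (X ⟶ Y) :=
  inferInstanceAs (PartialOrder {f : X.as ⟶ Y.as // j.cl f = f})

instance fixSupSet (X Y : j.Fix) : SupSet (X ⟶ Y) where
  sSup S := ⟨j.cl (sSup ((fun f : {f : X.as ⟶ Y.as // j.cl f = f} => f.1) '' S)), j.idem _⟩

instance fixQuantaloid : Quantaloid j.Fix where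
  homLattice X Y := completeLatticeOfSup (X ⟶ Y) fun S =>
    ⟨fun f hf => show f.1 ≤ j.cl (sSup (Subtype.val '' S)) from
      (le_sSup (Set.mem_image_of_mem Subtype.val hf)).trans (j.le _),
     fun f hf => show j.cl (sSup (Subtype.val '' S)) ≤ f.1 from
      (j.mono (sSup_le (by rintro _ ⟨g, hg, rfl⟩; exact hf hg))).trans f.2.le⟩
  sSup_comp S g := Subtype.ext (by
    change j.cl (j.cl (sSup _) ≫ g.1) = j.cl (sSup _)
    rw [cl_comp_left, Quantaloid.sSup_comp, ← cl_sSup_cl]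
    simp only [Set.image_image]; rfl)
  comp_sSup f S := Subtype.ext (by
    change j.cl (f.1 ≫ j.cl (sSup _)) = j.cl (sSup _)
    rw [cl_comp_right, Quantaloid.comp_sSup, ← cl_sSup_cl]
    simp only [Set.image_image]; rfl)

end QNucleus

/-! ### Categories enriched in a small quantaloid, and their distributors -/

/-- A category enriched in the quantaloid `Q`.  The underlying set over the set of objects of `Q`
is given by its fibres: `X.obj q` is the set of elements of type `q`. -/
structure QCat (Q : Type u) [SmallCategory Q] [Quantaloid Q] where
  obj : Q → Type u
  hom : ∀ {p q : Q}, obj p → obj q → (p ⟶ q)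
  id_le : ∀ {q : Q} (x : obj q), 𝟙 q ≤ hom x x
  comp_le : ∀ {p q r : Q} (x : obj p) (y : obj q) (z : obj r), hom x y ≫ hom y z ≤ hom x z

section Enriched

variable {Q : Type u} [SmallCategory Q] [Quantaloid Q]

/-- A distributor `φ : X ⇸ Y` between `Q`-categories. -/
structure Dist (X Y : QCat Q) where
  app : ∀ {p q : Q}, X.obj p → Y.obj q → (p ⟶ q)
  law : ∀ {p' p q q' : Q} (x' : X.obj p') (x : X.obj p) (y : Y.obj q) (y' : Y.obj q'),
    (X.hom x' x ≫ app x y) ≫ Y.hom y y' ≤ app x' y'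

namespace Dist

@[ext]
theorem ext {X Y : QCat Q} {φ ψ : Dist X Y}
    (h : ∀ {p q : Q} (x : X.obj p) (y : Y.obj q), φ.app x y = ψ.app x y) : φ = ψ := by
  obtain ⟨f, hf⟩ := φ
  obtain ⟨g, hg⟩ := ψ
  have : @f = @g := by
    funext p q x y; exact h x y
  cases this; rfl

theorem hom_app_le {X Y : QCat Q} (φ : Dist X Y) {p' p q : Q} (x' : X.obj p') (x : X.obj p)
    (y : Y.obj q) : X.hom x' x ≫ φ.app x y ≤ φ.app x' y := by
  refine le_trans ?_ (φ.law x' x y y)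
  conv_lhs => rw [← Category.comp_id (X.hom x' x ≫ φ.app x y)]
  exact comp_le_comp le_rfl (Y.id_le y)

theorem app_hom_le {X Y : QCat Q} (φ : Dist X Y) {p q q' : Q} (x : X.obj p)
    (y : Y.obj q) (y' : Y.obj q') : φ.app x y ≫ Y.hom y y' ≤ φ.app x y' := by
  refine le_trans ?_ (φ.law x x y y')
  refine comp_le_comp ?_ le_rfl
  conv_lhs => rw [← Category.id_comp (φ.app x y)]
  exact comp_le_comp (X.id_le x) le_rfl

/-- The pointwise order of distributors. -/
instance distPartialOrder (X Y : QCat Q) : PartialOrder (Dist X Y) where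
  le φ ψ := ∀ (p q : Q) (x : X.obj p) (y : Y.obj q), φ.app x y ≤ ψ.app x y
  le_refl _ _ _ _ _ := le_rfl
  le_trans _ _ _ h h' p q x y := (h p q x y).trans (h' p q x y)
  le_antisymm _ _ h h' := Dist.ext fun {p q} x y => le_antisymm (h p q x y) (h' p q x y)

instance distSupSet (X Y : QCat Q) : SupSet (Dist X Y) where
  sSup S :=
    { app := fun x y => ⨆ φ : S, φ.1.app x y
      law := fun x' x y y' => by
        rw [comp_iSup, iSup_comp]
        exact iSup_mono fun φ => φ.1.law x' x y y' }

instance distLattice (X Y : QCat Q) : CompleteLattice (Dist X Y) :=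
  completeLatticeOfSup _ fun S =>
    ⟨fun φ hφ _ _ x y => le_iSup (fun ψ : S => ψ.1.app x y) ⟨φ, hφ⟩,
     fun _ hφ _ _ x y => iSup_le fun ψ => hφ ψ.2 _ _ x y⟩

theorem sSup_app {X Y : QCat Q} (S : Set (Dist X Y)) {p q : Q} (x : X.obj p) (y : Y.obj q) :
    (sSup S).app x y = ⨆ φ : S, φ.1.app x y := rfl

/-- The identity distributor on `X` is the hom of `X`. -/
def id (X : QCat Q) : Dist X X where
  app x y := X.hom x y
  law _ _ _ _ := (comp_le_comp (X.comp_le _ _ _) le_rfl).trans (X.comp_le _ _ _)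

/-- The composite of distributors:
`(ψ ∘ φ)(x, z) = ⋁ y, ψ(y, z) ∘ φ(x, y)`. -/
def comp {X Y Z : QCat Q} (φ : Dist X Y) (ψ : Dist Y Z) : Dist X Z where
  app x z := ⨆ (q : Q) (y : Y.obj q), φ.app x y ≫ ψ.app y z
  law x' x z z' := by
    simp only [comp_iSup, iSup_comp]
    refine iSup₂_mono fun q y => ?_
    rw [← Category.assoc, Category.assoc]
    exact comp_le_comp (φ.hom_app_le _ _ _) (ψ.app_hom_le _ _ _)

end Dist

/-- `Q`-categories and distributors form a category. -/
instance distCategory : Category.{u} (QCat Q) where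
  Hom X Y := Dist X Y
  id X := Dist.id X
  comp φ ψ := Dist.comp φ ψ
  id_comp {X Y} φ := Dist.ext fun {p q} x y => by
    refine le_antisymm (iSup₂_le fun p' x' => φ.hom_app_le x x' y) ?_
    refine le_trans ?_ (le_iSup₂ (f := fun p' (x' : X.obj p') => X.hom x x' ≫ φ.app x' y) p x)
    conv_lhs => rw [← Category.id_comp (φ.app x y)]
    exact comp_le_comp (X.id_le x) le_rfl
  comp_id {X Y} φ := Dist.ext fun {p q} x y => by
    refine le_antisymm (iSup₂_le fun q' y' => φ.app_hom_le x y' y) ?_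
    refine le_trans ?_ (le_iSup₂ (f := fun q' (y' : Y.obj q') => φ.app x y' ≫ Y.hom y' y) q y)
    conv_lhs => rw [← Category.comp_id (φ.app x y)]
    exact comp_le_comp le_rfl (Y.id_le y)
  assoc {X Y Z W} φ ψ χ := Dist.ext fun {p q} x w => by
    change (⨆ (r : Q) (z : Z.obj r), (⨆ (s : Q) (y : Y.obj s), φ.app x y ≫ ψ.app y z) ≫ χ.app z w)
      = ⨆ (s : Q) (y : Y.obj s), φ.app x y ≫ ⨆ (r : Q) (z : Z.obj r), ψ.app y z ≫ χ.app z w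
    simp only [comp_iSup, iSup_comp, Category.assoc]
    refine le_antisymm ?_ ?_
    · exact iSup₂_le fun r z => iSup₂_le fun s y =>
        le_iSup₂_of_le s y (le_iSup₂_of_le r z le_rfl)
    · exact iSup₂_le fun s y => iSup₂_le fun r z =>
        le_iSup₂_of_le r z (le_iSup₂_of_le s y le_rfl)

theorem comp_app {X Y Z : QCat Q} (φ : X ⟶ Y) (ψ : Y ⟶ Z) {p r : Q} (x : X.obj p) (z : Z.obj r) :
    Dist.app (φ ≫ ψ) x z = ⨆ (q : Q) (y : Y.obj q), Dist.app φ x y ≫ Dist.app ψ y z := rfl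

theorem le_comp_app {X Y Z : QCat Q} (φ : X ⟶ Y) (ψ : Y ⟶ Z) {p q r : Q} (x : X.obj p)
    (y : Y.obj q) (z : Z.obj r) : Dist.app φ x y ≫ Dist.app ψ y z ≤ Dist.app (φ ≫ ψ) x z :=
  le_iSup₂ (f := fun q (y : Y.obj q) => Dist.app φ x y ≫ Dist.app ψ y z) q y

/-- The (large) quantaloid of `Q`-categories and distributors. -/
instance distQuantaloid : Quantaloid (QCat Q) where
  homLattice X Y := inferInstanceAs (CompleteLattice (Dist X Y))
  sSup_comp {X Y Z} S ψ := Dist.ext fun {p r} x z => by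
    change (⨆ (q : Q) (y : Y.obj q), (⨆ φ : S, Dist.app φ.1 x y) ≫ Dist.app ψ y z) =
      ⨆ χ : ((fun φ => φ ≫ ψ) '' S : Set (X ⟶ Z)), Dist.app χ.1 x z
    simp only [iSup_comp]
    refine le_antisymm (iSup₂_le fun q y => iSup_le fun φ => ?_) (iSup_le ?_)
    · exact le_trans (le_comp_app φ.1 ψ x y z)
        (le_iSup (fun χ : ((fun φ => φ ≫ ψ) '' S : Set (X ⟶ Z)) => Dist.app χ.1 x z)
          ⟨_, φ.1, φ.2, rfl⟩)
    · rintro ⟨_, φ, hφ, rfl⟩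
      exact iSup₂_mono fun q y =>
        le_iSup (fun φ : S => Dist.app φ.1 x y ≫ Dist.app ψ y z) ⟨φ, hφ⟩
  comp_sSup {X Y Z} φ S := Dist.ext fun {p r} x z => by
    change (⨆ (q : Q) (y : Y.obj q), Dist.app φ x y ≫ (⨆ ψ : S, Dist.app ψ.1 y z)) =
      ⨆ χ : ((fun ψ => φ ≫ ψ) '' S : Set (X ⟶ Z)), Dist.app χ.1 x z
    simp only [comp_iSup]
    refine le_antisymm (iSup₂_le fun q y => iSup_le fun ψ => ?_) (iSup_le ?_)
    · exact le_trans (le_comp_app φ ψ.1 x y z)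
        (le_iSup (fun χ : ((fun ψ => φ ≫ ψ) '' S : Set (X ⟶ Z)) => Dist.app χ.1 x z)
          ⟨_, ψ.1, ψ.2, rfl⟩)
    · rintro ⟨_, ψ, hψ, rfl⟩
      exact iSup₂_mono fun q y =>
        le_iSup (fun ψ : S => Dist.app φ x y ≫ Dist.app ψ.1 y z) ⟨ψ, hψ⟩

variable (Q) in
/-- The quantaloid `Q-Dist`. -/
abbrev QDist : Type (u + 1) := QCat Q

/-! ### Functors between enriched categories -/

/-- The underlying (pre)order of a `Q`-category, on elements of the same type. -/
def QCat.le (X : QCat Q) {q : Q} (x y : X.obj q) : Prop := 𝟙 q ≤ X.hom x y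

theorem QCat.le_refl (X : QCat Q) {q : Q} (x : X.obj q) : X.le x x := X.id_le x

theorem QCat.le_trans (X : QCat Q) {q : Q} {x y z : X.obj q} (h : X.le x y) (h' : X.le y z) :
    X.le x z := by
  refine _root_.le_trans ?_ (X.comp_le x y z)
  conv_lhs => rw [← Category.comp_id (𝟙 q)]
  exact comp_le_comp h h'

/-- A `Q`-category is separated if isomorphic elements are equal. -/
def QCat.IsSeparated (X : QCat Q) : Prop :=
  ∀ {q : Q} (x y : X.obj q), X.le x y → X.le y x → x = y

/-- A `Q`-functor: a type-preserving map that increases hom-arrows. -/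
@[ext]
structure QFunctor (X Y : QCat Q) where
  map : ∀ {q : Q}, X.obj q → Y.obj q
  hom_le : ∀ {p q : Q} (x : X.obj p) (y : X.obj q), X.hom x y ≤ Y.hom (map x) (map y)

namespace QFunctor

theorem ext' {X Y : QCat Q} {f g : QFunctor X Y}
    (h : ∀ {q : Q} (x : X.obj q), f.map x = g.map x) : f = g := by
  apply QFunctor.ext
  funext q x; exact h x

theorem map_le {X Y : QCat Q} (f : QFunctor X Y) {q : Q} {x y : X.obj q} (h : X.le x y) :
    Y.le (f.map x) (f.map y) := le_trans h (f.hom_le x y)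

/-- The identity functor. -/
def id (X : QCat Q) : QFunctor X X := ⟨fun x => x, fun _ _ => le_rfl⟩

/-- The composite `g ∘ f` of functors. -/
def comp {X Y Z : QCat Q} (g : QFunctor Y Z) (f : QFunctor X Y) : QFunctor X Z :=
  ⟨fun x => g.map (f.map x), fun x y => (f.hom_le x y).trans (g.hom_le _ _)⟩

/-- The pointwise (pre)order of functors. -/
instance functorLE (X Y : QCat Q) : LE (QFunctor X Y) :=
  ⟨fun f g => ∀ (q : Q) (x : X.obj q), Y.le (f.map x) (g.map x)⟩

/-- The adjunction `f ⊣ g` of functors. -/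
def Adj {X Y : QCat Q} (f : QFunctor X Y) (g : QFunctor Y X) : Prop :=
  ∀ {p q : Q} (x : X.obj p) (y : Y.obj q), Y.hom (f.map x) y = X.hom x (g.map y)

end QFunctor

/-! ### Presheaves -/

/-- The carrier of the one-object `Q`-category `{q}`. -/
inductive Pt (q : Q) : Q → Type u
  | star : Pt q q

/-- The one-object `Q`-category `{q}`, whose only element has type `q` and hom `𝟙 q`. -/
def pt (q : Q) : QCat Q where
  obj := Pt q
  hom := fun x y => match x, y with
    | .star, .star => 𝟙 q
  id_le := by rintro _ ⟨⟩; exact le_rfl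
  comp_le := by rintro _ _ _ ⟨⟩ ⟨⟩ ⟨⟩; exact (Category.comp_id _).le

/-- The only element of `{q}`. -/
def star {q : Q} : (pt q).obj q := Pt.star

theorem ptDist_ext {X : QCat Q} {q : Q} {μ ν : X ⟶ pt q}
    (h : ∀ {p : Q} (x : X.obj p), Dist.app μ x star = Dist.app ν x star) : μ = ν :=
  Dist.ext fun x y => by cases y; exact h x

theorem ptDist_le_iff {X : QCat Q} {q : Q} {μ ν : X ⟶ pt q} :
    μ ≤ ν ↔ ∀ {p : Q} (x : X.obj p), Dist.app μ x star ≤ Dist.app ν x star :=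
  ⟨fun h _ x => h _ _ x star, fun h _ _ x y => by cases y; exact h x⟩

/-- An arrow `f : p ⟶ q`, seen as a distributor `{p} ⇸ {q}`. -/
def arrowDist {p q : Q} (f : p ⟶ q) : pt p ⟶ pt q :=
  { app := fun x y => match x, y with
      | .star, .star => f
    law := by
      rintro _ _ _ _ ⟨⟩ ⟨⟩ ⟨⟩ ⟨⟩
      change (𝟙 _ ≫ f) ≫ 𝟙 _ ≤ f
      rw [Category.id_comp, Category.comp_id] : Dist (pt p) (pt q) }

theorem le_lda_app_iff {X : QCat Q} {p q : Q} {μ : X ⟶ pt p} {ν : X ⟶ pt q} {f : p ⟶ q} :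
    f ≤ Dist.app (lda ν μ) star star ↔
      ∀ {r : Q} (x : X.obj r), Dist.app μ x star ≫ f ≤ Dist.app ν x star := by
  constructor
  · intro h r x
    have h1 : μ ≫ lda ν μ ≤ ν := le_lda_iff.1 le_rfl
    exact (comp_le_comp le_rfl h).trans ((le_comp_app μ (lda ν μ) x star star).trans (h1 _ _ x star))
  · intro h
    have h1 : arrowDist f ≤ lda ν μ := by
      rw [le_lda_iff]
      rintro r _ x ⟨⟩
      refine iSup₂_le ?_
      rintro _ ⟨⟩
      exact h x
    exact h1 _ _ star star

/-- The presheaf `Q`-category `PX`: its elements of type `q` are the distributors `X ⇸ {q}`, and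
the hom from `μ` to `μ'` is `μ' ↙ μ` (a distributor `{p} ⇸ {q}`, i.e. an arrow `p ⟶ q`). -/
abbrev Psh (X : QCat Q) : QCat Q where
  obj q := X ⟶ pt q
  hom μ μ' := Dist.app (lda μ' μ) star star
  id_le μ := le_lda_app_iff.2 fun x => (Category.comp_id _).le
  comp_le μ μ' μ'' := le_lda_app_iff.2 fun x => by
    rw [← Category.assoc]
    exact (comp_le_comp (le_lda_app_iff.1 le_rfl x) le_rfl).trans (le_lda_app_iff.1 le_rfl x)

theorem le_psh_hom_iff {X : QCat Q} {p q : Q} {μ : (Psh X).obj p} {ν : (Psh X).obj q}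
    {f : p ⟶ q} : f ≤ (Psh X).hom μ ν ↔
      ∀ {r : Q} (x : X.obj r), Dist.app μ x star ≫ f ≤ Dist.app ν x star :=
  le_lda_app_iff

/-- The underlying order of `PX` is the order of distributors. -/
theorem psh_le_iff {X : QCat Q} {q : Q} {μ ν : X ⟶ pt q} : (Psh X).le μ ν ↔ μ ≤ ν := by
  unfold QCat.le
  rw [le_psh_hom_iff, ptDist_le_iff]
  simp only [Category.comp_id]

/-- The presheaf `φ(-, y)` for a distributor `φ : X ⇸ Y` and `y ∈ Y`. -/
def col {X Y : QCat Q} (φ : X ⟶ Y) {q : Q} (y : Y.obj q) : (Psh X).obj q :=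
  { app := fun x s => match s with
      | .star => Dist.app φ x y
    law := by
      rintro _ _ _ _ x' x ⟨⟩ ⟨⟩
      change (X.hom x' x ≫ Dist.app φ x y) ≫ 𝟙 _ ≤ Dist.app φ x' y
      rw [Category.comp_id]
      exact Dist.hom_app_le φ x' x y : Dist X (pt q) }

/-- The transpose `Y → PX`, `y ↦ φ(-, y)`, of a distributor `φ : X ⇸ Y`. -/
def transpose {X Y : QCat Q} (φ : X ⟶ Y) : QFunctor Y (Psh X) where
  map y := col φ y
  hom_le y y' := le_psh_hom_iff.2 fun x => Dist.app_hom_le φ x y y'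

/-- The distributor `X ⇸ Y`, `(x, y) ↦ (g y)(x)`, with a given transpose `g : Y → PX`. -/
def ofTranspose {X Y : QCat Q} (g : QFunctor Y (Psh X)) : X ⟶ Y :=
  { app := fun x y => Dist.app (g.map y) x star
    law := fun x' x y y' =>
      (comp_le_comp (Dist.hom_app_le (g.map y) x' x star) (g.hom_le y y')).trans
        (le_psh_hom_iff.1 le_rfl x') : Dist X Y }

theorem transpose_ofTranspose {X Y : QCat Q} (g : QFunctor Y (Psh X)) :
    transpose (ofTranspose g) = g :=
  QFunctor.ext' fun _ => ptDist_ext fun _ => rfl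

theorem ofTranspose_transpose {X Y : QCat Q} (φ : X ⟶ Y) : ofTranspose (transpose φ) = φ := rfl

/-- The Yoneda embedding `X → PX`, `x ↦ X(-, x)`. -/
def yoneda (X : QCat Q) : QFunctor X (Psh X) := transpose (𝟙 X)

/-- The left adjoint `φ^* : PY → PX`, `λ ↦ λ ∘ φ`, of the Kan adjunction of `φ : X ⇸ Y`. -/
def kan {X Y : QCat Q} (φ : X ⟶ Y) : QFunctor (Psh Y) (Psh X) where
  map μ := φ ≫ μ
  hom_le μ ν := le_psh_hom_iff.2 fun x => by
    refine (comp_le_comp (iSup₂_le fun r y => ?_) le_rfl).trans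
      (le_lda_iff (w := Dist.app (φ ≫ ν) x star) (u := ⨆ (r : Q) (y : Y.obj r),
        Dist.app φ x y ≫ Dist.app μ y star).1 ?_)
    · exact le_iSup₂ (f := fun r (y : Y.obj r) => Dist.app φ x y ≫ Dist.app μ y star) r y
    · rw [le_lda_iff]
      simp only [iSup_comp]
      refine iSup₂_le fun r y => ?_
      rw [Category.assoc]
      exact (comp_le_comp le_rfl (le_psh_hom_iff.1 le_rfl y)).trans (le_comp_app φ ν x y star)

/-! ### Spaces: presheaf categories with an operator -/

/-- A distributor `ζ : X ⇸ Y` is continuous with respect to operators `σ` on `PX` and `τ` on `PY`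
if `ζ^* τ ≤ σ ζ^*` as functors `PY → PX`. -/
def IsContinuous {X Y : QCat Q} (σ : QFunctor (Psh X) (Psh X)) (τ : QFunctor (Psh Y) (Psh Y))
    (ζ : X ⟶ Y) : Prop :=
  (kan ζ).comp τ ≤ σ.comp (kan ζ)

theorem isContinuous_iff {X Y : QCat Q} {σ : QFunctor (Psh X) (Psh X)}
    {τ : QFunctor (Psh Y) (Psh Y)} {ζ : X ⟶ Y} :
    IsContinuous σ τ ζ ↔ ∀ {q : Q} (μ : Y ⟶ pt q),
      (ζ ≫ (τ.map μ : Y ⟶ pt q) : X ⟶ pt q) ≤ σ.map (ζ ≫ μ : X ⟶ pt q) :=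
  ⟨fun h _ μ => psh_le_iff.1 (h _ μ), fun h _ μ => psh_le_iff.2 (h μ)⟩

theorem op_mono {X : QCat Q} (σ : QFunctor (Psh X) (Psh X)) {q : Q} {μ ν : X ⟶ pt q}
    (h : μ ≤ ν) : (σ.map μ : X ⟶ pt q) ≤ σ.map ν :=
  psh_le_iff.1 (σ.map_le (psh_le_iff.2 h))

theorem isContinuous_id {X : QCat Q} (σ : QFunctor (Psh X) (Psh X)) : IsContinuous σ σ (𝟙 X) :=
  isContinuous_iff.2 fun μ => by rw [Category.id_comp, Category.id_comp]

theorem IsContinuous.comp {X Y Z : QCat Q} {σ : QFunctor (Psh X) (Psh X)}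
    {τ : QFunctor (Psh Y) (Psh Y)} {ρ : QFunctor (Psh Z) (Psh Z)} {ζ : X ⟶ Y} {η : Y ⟶ Z}
    (hζ : IsContinuous σ τ ζ) (hη : IsContinuous τ ρ η) : IsContinuous σ ρ (ζ ≫ η) :=
  isContinuous_iff.2 fun μ => by
    rw [Category.assoc, Category.assoc]
    exact (comp_le_comp le_rfl (isContinuous_iff.1 hη μ)).trans (isContinuous_iff.1 hζ _)

theorem isContinuous_sSup {X Y : QCat Q} {σ : QFunctor (Psh X) (Psh X)}
    {τ : QFunctor (Psh Y) (Psh Y)} {S : Set (X ⟶ Y)} (h : ∀ ζ ∈ S, IsContinuous σ τ ζ) :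
    IsContinuous σ τ (sSup S) :=
  isContinuous_iff.2 fun μ => by
    rw [Quantaloid.sSup_comp]
    refine sSup_le ?_
    rintro _ ⟨ζ, hζ, rfl⟩
    exact (isContinuous_iff.1 (h ζ hζ) μ).trans (op_mono σ (comp_le_comp (le_sSup hζ) le_rfl))

/-! ### Interior spaces -/

variable (Q) in
/-- A `Q`-interior space: a `Q`-category `X` with an interior operator on `PX`.  The arrows of the
quantaloid `QIntDist Q` are the continuous distributors. -/
structure QIntDist where
  carrier : QCat Q
  int : QFunctor (Psh carrier) (Psh carrier)
  int_le : int ≤ QFunctor.id (Psh carrier)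
  int_int : int.comp int = int

instance intDistCategory : Category.{u} (QIntDist Q) where
  Hom X Y := {ζ : X.carrier ⟶ Y.carrier // IsContinuous X.int Y.int ζ}
  id X := ⟨𝟙 X.carrier, isContinuous_id X.int⟩
  comp ζ η := ⟨ζ.1 ≫ η.1, ζ.2.comp η.2⟩
  id_comp ζ := Subtype.ext (Category.id_comp ζ.1)
  comp_id ζ := Subtype.ext (Category.comp_id ζ.1)
  assoc ζ η ξ := Subtype.ext (Category.assoc ζ.1 η.1 ξ.1)

instance intDistPartialOrder (X Y : QIntDist Q) : PartialOrder (X ⟶ Y) :=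
  PartialOrder.lift (fun ζ : {ζ : X.carrier ⟶ Y.carrier // IsContinuous X.int Y.int ζ} => ζ.1)
    Subtype.val_injective

instance intDistSupSet (X Y : QIntDist Q) : SupSet (X ⟶ Y) where
  sSup S := ⟨sSup ((fun ζ : {ζ : X.carrier ⟶ Y.carrier // IsContinuous X.int Y.int ζ} => ζ.1) '' S),
    isContinuous_sSup (by rintro _ ⟨ζ, _, rfl⟩; exact ζ.2)⟩

/-- The quantaloid of interior spaces and continuous distributors, with the order of
distributors. -/
instance intDistQuantaloid : Quantaloid (QIntDist Q) where
  homLattice X Y := completeLatticeOfSup (X ⟶ Y) fun S =>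
    ⟨fun ζ hζ => show ζ.1 ≤ sSup (Subtype.val '' S) from
      le_sSup (Set.mem_image_of_mem Subtype.val hζ),
     fun ζ hζ => show sSup (Subtype.val '' S) ≤ ζ.1 from
      sSup_le (by rintro _ ⟨η, hη, rfl⟩; exact hζ hη)⟩
  sSup_comp S η := Subtype.ext (by
    change sSup _ ≫ η.1 = sSup _
    rw [Quantaloid.sSup_comp, Set.image_image, Set.image_image]; rfl)
  comp_sSup ζ S := Subtype.ext (by
    change ζ.1 ≫ sSup _ = sSup _
    rw [Quantaloid.comp_sSup, Set.image_image, Set.image_image]; rfl)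

variable (Q) in
/-- Continuous distributors `ζ, ζ' : (X, σ) ⇸ (Y, τ)` are identified if `ζ^* τ = ζ'^* τ`. -/
def openCongruence : Congruence (QIntDist Q) where
  rel X Y :=
    { r := fun ζ ζ' => (kan ζ.1).comp Y.int = (kan ζ'.1).comp Y.int
      iseqv := ⟨fun _ => rfl, fun h => h.symm, fun h h' => h.trans h'⟩ }
  comp {X Y Z ζ ζ' η η'} h h' := by
    change (kan ζ.1).comp Y.int = (kan ζ'.1).comp Y.int at h
    change (kan η.1).comp Z.int = (kan η'.1).comp Z.int at h'
    change (kan (ζ.1 ≫ η.1)).comp Z.int = (kan (ζ'.1 ≫ η'.1)).comp Z.int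
    refine QFunctor.ext' fun {q} (μ : Z.carrier ⟶ pt q) => ?_
    have e1 : ∀ ν : Y.carrier ⟶ pt q,
        (ζ.1 ≫ Y.int.map ν : X.carrier ⟶ pt q) = ζ'.1 ≫ Y.int.map ν := fun ν =>
      congrArg (fun F : QFunctor (Psh Y.carrier) (Psh X.carrier) => F.map ν) h
    have e2 : (η.1 ≫ Z.int.map μ : Y.carrier ⟶ pt q) = η'.1 ≫ Z.int.map μ :=
      congrArg (fun F : QFunctor (Psh Z.carrier) (Psh Y.carrier) => F.map μ) h'
    have e3 : (Y.int.map (η.1 ≫ Z.int.map μ : Y.carrier ⟶ pt q) : Y.carrier ⟶ pt q) =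
        η.1 ≫ Z.int.map μ := by
      refine le_antisymm (psh_le_iff.1 (Y.int_le _ _)) ?_
      have h3 := isContinuous_iff.1 η.2 (Z.int.map μ)
      have h4 : (Z.int.map (Z.int.map μ)) = Z.int.map μ :=
        congrArg (fun F : QFunctor (Psh Z.carrier) (Psh Z.carrier) => F.map μ) Z.int_int
      rwa [h4] at h3
    change ((ζ.1 ≫ η.1) ≫ Z.int.map μ : X.carrier ⟶ pt q) = (ζ'.1 ≫ η'.1) ≫ Z.int.map μ
    rw [Category.assoc, Category.assoc, ← e2, ← e3, e1]
  iSup {X Y ι} ζ ζ' h := by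
    refine QFunctor.ext' fun {q} (μ : Y.carrier ⟶ pt q) => ?_
    have e : ∀ i, ((ζ i).1 ≫ Y.int.map μ : X.carrier ⟶ pt q) = (ζ' i).1 ≫ Y.int.map μ :=
      fun i => congrArg (fun F : QFunctor (Psh Y.carrier) (Psh X.carrier) => F.map μ) (h i)
    change (sSup _ ≫ Y.int.map μ : X.carrier ⟶ pt q) = sSup _ ≫ Y.int.map μ
    rw [Quantaloid.sSup_comp, Quantaloid.sSup_comp]
    congr 1
    simp only [← Set.range_comp]
    exact congrArg Set.range (funext e)

variable (Q) in
/-- The quotient quantaloid `(Q-IntDist)ₒ`. -/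
abbrev QIntDistO : Type (u + 1) := (openCongruence Q).Quot

/-! ### Closure spaces -/

variable (Q) in
/-- A `Q`-closure space: a `Q`-category `X` with a closure operator on `PX`.  The arrows of the
quantaloid `QClsDist Q` are the continuous distributors. -/
structure QClsDist where
  carrier : QCat Q
  cls : QFunctor (Psh carrier) (Psh carrier)
  le_cls : QFunctor.id (Psh carrier) ≤ cls
  cls_cls : cls.comp cls = cls

instance clsDistCategory : Category.{u} (QClsDist Q) where
  Hom X Y := {ζ : X.carrier ⟶ Y.carrier // IsContinuous X.cls Y.cls ζ}
  id X := ⟨𝟙 X.carrier, isContinuous_id X.cls⟩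
  comp ζ η := ⟨ζ.1 ≫ η.1, ζ.2.comp η.2⟩
  id_comp ζ := Subtype.ext (Category.id_comp ζ.1)
  comp_id ζ := Subtype.ext (Category.comp_id ζ.1)
  assoc ζ η ξ := Subtype.ext (Category.assoc ζ.1 η.1 ξ.1)

instance clsDistPartialOrder (X Y : QClsDist Q) : PartialOrder (X ⟶ Y) :=
  PartialOrder.lift (fun ζ : {ζ : X.carrier ⟶ Y.carrier // IsContinuous X.cls Y.cls ζ} => ζ.1)
    Subtype.val_injective

instance clsDistSupSet (X Y : QClsDist Q) : SupSet (X ⟶ Y) where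
  sSup S := ⟨sSup ((fun ζ : {ζ : X.carrier ⟶ Y.carrier // IsContinuous X.cls Y.cls ζ} => ζ.1) '' S),
    isContinuous_sSup (by rintro _ ⟨ζ, _, rfl⟩; exact ζ.2)⟩

/-- The quantaloid of closure spaces and continuous distributors, with the order of
distributors. -/
instance clsDistQuantaloid : Quantaloid (QClsDist Q) where
  homLattice X Y := completeLatticeOfSup (X ⟶ Y) fun S =>
    ⟨fun ζ hζ => show ζ.1 ≤ sSup (Subtype.val '' S) from
      le_sSup (Set.mem_image_of_mem Subtype.val hζ),
     fun ζ hζ => show sSup (Subtype.val '' S) ≤ ζ.1 from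
      sSup_le (by rintro _ ⟨η, hη, rfl⟩; exact hζ hη)⟩
  sSup_comp S η := Subtype.ext (by
    change sSup _ ≫ η.1 = sSup _
    rw [Quantaloid.sSup_comp, Set.image_image, Set.image_image]; rfl)
  comp_sSup ζ S := Subtype.ext (by
    change ζ.1 ≫ sSup _ = sSup _
    rw [Quantaloid.comp_sSup, Set.image_image, Set.image_image]; rfl)

/-- The closure of a distributor `ζ : X ⇸ Y` with respect to an operator `c` on `PX`: the
distributor whose transpose is `y ↦ c (ζ(-, y))`. -/
def distClosure {X Y : QCat Q} (c : QFunctor (Psh X) (Psh X)) (ζ : X ⟶ Y) : X ⟶ Y :=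
  ofTranspose (c.comp (transpose ζ))

/-- A distributor `ζ : (X, c) ⇸ Y` is closed if each presheaf `ζ(-, y)` is closed. -/
def IsClosedDist {X Y : QCat Q} (c : QFunctor (Psh X) (Psh X)) (ζ : X ⟶ Y) : Prop :=
  ∀ {q : Q} (y : Y.obj q), c.map (col ζ y) = col ζ y

theorem distClosure_eq_iff {X Y : QCat Q} {c : QFunctor (Psh X) (Psh X)} {ζ : X ⟶ Y} :
    distClosure c ζ = ζ ↔ IsClosedDist c ζ := by
  constructor
  · intro h q y
    have h1 := transpose_ofTranspose (c.comp (transpose ζ))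
    rw [show ofTranspose (c.comp (transpose ζ)) = ζ from h] at h1
    exact (congrArg (fun F : QFunctor Y (Psh X) => F.map y) h1).symm
  · intro h
    have h1 : c.comp (transpose ζ) = transpose ζ := QFunctor.ext' fun y => h y
    rw [distClosure, h1, ofTranspose_transpose]

theorem col_distClosure {X Y : QCat Q} (c : QFunctor (Psh X) (Psh X)) (ζ : X ⟶ Y) {q : Q}
    (y : Y.obj q) : col (distClosure c ζ) y = c.map (col ζ y) :=
  congrArg (fun F : QFunctor Y (Psh X) => F.map y) (transpose_ofTranspose (c.comp (transpose ζ)))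

theorem dist_le_iff_col {X Y : QCat Q} {ζ η : X ⟶ Y} :
    ζ ≤ η ↔ ∀ {q : Q} (y : Y.obj q), (col ζ y : X ⟶ pt q) ≤ col η y := by
  refine ⟨fun h q y => ptDist_le_iff.2 fun x => h _ _ x y, fun h _ _ x y => h y _ _ x star⟩

theorem col_comp {X Y Z : QCat Q} (ζ : X ⟶ Y) (η : Y ⟶ Z) {q : Q} (z : Z.obj q) :
    (col (ζ ≫ η) z : X ⟶ pt q) = ζ ≫ (col η z : Y ⟶ pt q) :=
  ptDist_ext fun _ => rfl

/-- `(cl ζ)^* ≤ c ζ^*`. -/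
theorem distClosure_comp_le {X Y : QCat Q} (c : QFunctor (Psh X) (Psh X)) (ζ : X ⟶ Y) {q : Q}
    (μ : Y ⟶ pt q) : (distClosure c ζ ≫ μ : X ⟶ pt q) ≤ c.map (ζ ≫ μ : X ⟶ pt q) := by
  rw [ptDist_le_iff]
  intro p x
  rw [comp_app]
  refine iSup₂_le fun r y => ?_
  have h1 : Dist.app μ y star ≤ (Psh X).hom (col ζ y) (ζ ≫ μ : X ⟶ pt q) :=
    le_psh_hom_iff.2 fun x' => le_comp_app ζ μ x' y star
  exact le_psh_hom_iff.1 (h1.trans (c.hom_le _ _)) x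

theorem QClsDist.le_map (X : QClsDist Q) {q : Q} (μ : X.carrier ⟶ pt q) : μ ≤ X.cls.map μ :=
  psh_le_iff.1 (X.le_cls _ μ)

theorem QClsDist.map_map (X : QClsDist Q) {q : Q} (μ : X.carrier ⟶ pt q) :
    X.cls.map (X.cls.map μ) = X.cls.map μ :=
  congrArg (fun F : QFunctor (Psh X.carrier) (Psh X.carrier) => F.map μ) X.cls_cls

theorem QClsDist.le_distClosure (X : QClsDist Q) {Y : QCat Q} (ζ : X.carrier ⟶ Y) :
    ζ ≤ distClosure X.cls ζ :=
  dist_le_iff_col.2 fun y => by rw [col_distClosure]; exact X.le_map _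

theorem QClsDist.isContinuous_distClosure (X Y : QClsDist Q) {ζ : X.carrier ⟶ Y.carrier}
    (h : IsContinuous X.cls Y.cls ζ) : IsContinuous X.cls Y.cls (distClosure X.cls ζ) :=
  isContinuous_iff.2 fun {q} μ => by
    refine (distClosure_comp_le X.cls ζ (Y.cls.map μ)).trans ?_
    refine (op_mono X.cls (isContinuous_iff.1 h μ)).trans ?_
    rw [X.map_map]
    exact op_mono X.cls (comp_le_comp (X.le_distClosure ζ) le_rfl)

variable (Q) in
/-- The nucleus `ζ ↦ cl ζ` on the quantaloid of closure spaces and continuous distributors. -/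
def closureNucleus : QNucleus (QClsDist Q) where
  cl {X Y} ζ := ⟨distClosure X.cls ζ.1, X.isContinuous_distClosure Y ζ.2⟩
  mono {X Y ζ η} h := by
    change distClosure X.cls ζ.1 ≤ distClosure X.cls η.1
    rw [dist_le_iff_col]
    intro q y
    rw [col_distClosure, col_distClosure]
    exact op_mono X.cls (dist_le_iff_col.1 h y)
  le {X Y} ζ := X.le_distClosure ζ.1
  idem {X Y} ζ := Subtype.ext (distClosure_eq_iff.2 fun y => by
    rw [col_distClosure]; exact X.map_map _)
  comp {X Y Z} ζ η := by
    change distClosure X.cls ζ.1 ≫ distClosure Y.cls η.1 ≤ distClosure X.cls (ζ.1 ≫ η.1)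
    rw [dist_le_iff_col]
    intro q z
    rw [col_distClosure, col_comp, col_comp, col_distClosure]
    refine (distClosure_comp_le X.cls ζ.1 _).trans ?_
    refine (op_mono X.cls (isContinuous_iff.1 ζ.2 _)).trans ?_
    rw [X.map_map]

variable (Q) in
/-- The quantaloid `Q-ClsCloDist` of closure spaces and closed continuous distributors: its arrows
are the continuous distributors `ζ` with `cl ζ = ζ`, i.e. (`distClosure_eq_iff`) the closed ones;
the composite of `ζ` and `η` is `cl (η ∘ ζ)`, the identity is `cl 1_X`, and the join of a family
is the closure of its join in `Q-Dist`. -/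
abbrev QClsCloDist : Type (u + 1) := (closureNucleus Q).Fix

/-! ### Complete categories -/

/-- A `Q`-category is complete if every presheaf has a supremum, i.e. if the Yoneda embedding has a
left adjoint `sup : PX → X`. -/
def QCat.IsComplete (X : QCat Q) : Prop := ∃ s : QFunctor (Psh X) X, s.Adj (yoneda X)

/-- A functor is a left adjoint. -/
def QFunctor.IsLeftAdj {X Y : QCat Q} (f : QFunctor X Y) : Prop := ∃ g : QFunctor Y X, f.Adj g

variable (Q) in
/-- The objects of `Q-Sup` are the separated complete `Q`-categories. -/
structure QSup where
  carrier : QCat Q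
  separated : carrier.IsSeparated
  complete : carrier.IsComplete

instance supCategory : Category.{u} (QSup Q) where
  Hom X Y := {f : QFunctor X.carrier Y.carrier // f.IsLeftAdj}
  id X := ⟨QFunctor.id X.carrier, QFunctor.id X.carrier, fun _ _ => rfl⟩
  comp f g := ⟨g.1.comp f.1, by
    obtain ⟨f', hf⟩ := f.2
    obtain ⟨g', hg⟩ := g.2
    exact ⟨f'.comp g', fun x y => (hg _ _).trans (hf _ _)⟩⟩
  id_comp _ := rfl
  comp_id _ := rfl
  assoc _ _ _ := rfl

/-- The pointwise order of left adjoint functors. -/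
instance supPartialOrder (X Y : QSup Q) : PartialOrder (X ⟶ Y) where
  le f g := f.1 ≤ g.1
  le_refl f _ x := Y.carrier.le_refl (f.1.map x)
  le_trans _ _ _ hfg hgh _ x := Y.carrier.le_trans (hfg _ x) (hgh _ x)
  le_antisymm _ _ hfg hgf :=
    Subtype.ext (QFunctor.ext' fun x => Y.separated _ _ (hfg _ x) (hgf _ x))

theorem QCat.hom_eq_of_le {X : QCat Q} {p q : Q} {x x' : X.obj p} (h : X.le x x') (y : X.obj q) :
    X.hom x' y ≤ X.hom x y := by
  refine _root_.le_trans ?_ (X.comp_le x x' y)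
  conv_lhs => rw [← Category.id_comp (X.hom x' y)]
  exact comp_le_comp h le_rfl

theorem psh_hom_yoneda_ge {X : QCat Q} {p q : Q} {μ : X ⟶ pt p} {y : X.obj q} {f : p ⟶ q} :
    f ≤ (Psh X).hom μ ((yoneda X).map y) ↔
      ∀ {r : Q} (x : X.obj r), Dist.app μ x star ≫ f ≤ X.hom x y := le_psh_hom_iff

/-- Pointwise joins of left adjoint functors into a complete `Q`-category. -/
theorem exists_sup_functor {X Y : QCat Q} (hX : X.IsComplete) (hY : Y.IsComplete)
    (S : Set (QFunctor X Y)) (hS : ∀ f ∈ S, f.IsLeftAdj) :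
    ∃ F : QFunctor X Y, F.IsLeftAdj ∧ ∀ {p q : Q} (x : X.obj p) (y : Y.obj q),
      Y.hom (F.map x) y = ⨅ f : S, Y.hom (f.1.map x) y := by
  obtain ⟨sX, hsX⟩ := hX
  obtain ⟨sY, hsY⟩ := hY
  have key : ∃ F : QFunctor X Y, ∀ {p q : Q} (x : X.obj p) (y : Y.obj q),
      Y.hom (F.map x) y = ⨅ f : S, Y.hom (f.1.map x) y := by
    let m : ∀ {p : Q}, X.obj p → Y.obj p := fun {p} x =>
      sY.map (sSup (Set.range fun f : S => ((yoneda Y).map (f.1.map x) : Y ⟶ pt p)) : Y ⟶ pt p)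
    have hm : ∀ {p q : Q} (x : X.obj p) (y : Y.obj q),
        Y.hom (m x) y = ⨅ f : S, Y.hom (f.1.map x) y := by
      intro p q x y
      refine eq_of_forall_le_iff fun a => ?_
      rw [hsY, psh_hom_yoneda_ge, le_iInf_iff]
      constructor
      · intro h f
        have h1 : ((yoneda Y).map (f.1.map x) : Y ⟶ pt p) ≤
            sSup (Set.range fun f : S => ((yoneda Y).map (f.1.map x) : Y ⟶ pt p)) :=
          le_sSup ⟨f, rfl⟩
        have h2 := (comp_le_comp (h1 _ _ (f.1.map x) star) (le_refl a)).trans (h (f.1.map x))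
        refine le_trans ?_ h2
        conv_lhs => rw [← Category.id_comp a]
        exact comp_le_comp (Y.id_le _) le_rfl
      · intro h r y'
        refine le_lda_iff.1 ?_
        rw [le_lda_iff]
        change (⨆ φ : Set.range fun f : S => ((yoneda Y).map (f.1.map x) : Y ⟶ pt p),
          Dist.app φ.1 y' star) ≫ a ≤ _
        rw [iSup_comp]
        refine iSup_le ?_
        rintro ⟨_, f, rfl⟩
        exact (comp_le_comp le_rfl (h f)).trans (Y.comp_le _ _ _)
    refine ⟨⟨m, fun {p q} x x' => ?_⟩, hm⟩
    rw [hm]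
    refine le_iInf fun f => (f.1.hom_le x x').trans ?_
    have h1 : 𝟙 q ≤ Y.hom (f.1.map x') (m x') := by
      have h2 := Y.id_le (m x')
      rw [hm] at h2
      exact h2.trans (iInf_le _ f)
    refine le_trans ?_ (Y.comp_le _ (f.1.map x') _)
    conv_lhs => rw [← Category.comp_id (Y.hom (f.1.map x) (f.1.map x'))]
    exact comp_le_comp le_rfl h1
  obtain ⟨F, hF⟩ := key
  refine ⟨F, ?_, hF⟩
  let ρ : ∀ {q : Q}, Y.obj q → (X ⟶ pt q) := fun {q} y =>
    { app := fun x s => match s with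
        | .star => Y.hom (F.map x) y
      law := by
        rintro _ _ _ _ x' x ⟨⟩ ⟨⟩
        change (X.hom x' x ≫ Y.hom (F.map x) y) ≫ 𝟙 _ ≤ Y.hom (F.map x') y
        rw [Category.comp_id]
        exact (comp_le_comp (F.hom_le x' x) le_rfl).trans (Y.comp_le _ _ _) : Dist X (pt q) }
  refine ⟨⟨fun y => sX.map (ρ y), fun y y' => ?_⟩, fun {p q} x y => ?_⟩
  · refine le_trans ?_ (sX.hom_le _ _)
    exact le_psh_hom_iff.2 fun x => Y.comp_le _ _ _
  · apply le_antisymm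
    · have h1 : 𝟙 q ≤ (Psh X).hom (ρ y) ((yoneda X).map (sX.map (ρ y))) := by
        rw [← hsX]; exact X.id_le _
      have h2 := psh_hom_yoneda_ge.1 h1 x
      rwa [Category.comp_id] at h2
    · have h1 : 𝟙 q ≤ Y.hom (F.map (sX.map (ρ y))) y := by
        rw [hF]
        refine le_iInf fun f => ?_
        obtain ⟨g, hg⟩ := hS f.1 f.2
        rw [hg, hsX, psh_hom_yoneda_ge]
        intro r x'
        rw [Category.comp_id, ← hg]
        change Y.hom (F.map x') y ≤ _
        rw [hF]
        exact iInf_le _ f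
      refine (F.hom_le _ _).trans (le_trans ?_ (Y.comp_le _ (F.map (sX.map (ρ y))) _))
      conv_lhs => rw [← Category.comp_id (Y.hom (F.map x) (F.map (sX.map (ρ y))))]
      exact comp_le_comp le_rfl h1

theorem exists_sup_arrow {X Y : QSup Q} (S : Set (X ⟶ Y)) :
    ∃ F : X ⟶ Y, ∀ {p q : Q} (x : X.carrier.obj p) (y : Y.carrier.obj q),
      Y.carrier.hom (F.1.map x) y = ⨅ f : S, Y.carrier.hom (f.1.1.map x) y := by
  obtain ⟨F, hF, h⟩ := exists_sup_functor X.complete Y.complete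
    ((fun f : {f : QFunctor X.carrier Y.carrier // f.IsLeftAdj} => f.1) '' S)
    (by rintro _ ⟨f, _, rfl⟩; exact f.2)
  refine ⟨⟨F, hF⟩, fun x y => (h x y).trans (le_antisymm ?_ ?_)⟩
  · exact le_iInf fun f => iInf_le_of_le ⟨f.1.1, f.1, f.2, rfl⟩ le_rfl
  · refine le_iInf ?_
    rintro ⟨_, f, hf, rfl⟩
    exact iInf_le_of_le ⟨f, hf⟩ le_rfl

noncomputable instance supSupSet (X Y : QSup Q) : SupSet (X ⟶ Y) where
  sSup S := (exists_sup_arrow S).choose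

theorem sup_sSup_hom {X Y : QSup Q} (S : Set (X ⟶ Y)) {p q : Q} (x : X.carrier.obj p)
    (y : Y.carrier.obj q) : Y.carrier.hom ((sSup S).1.map x) y =
      ⨅ f : S, Y.carrier.hom (f.1.1.map x) y :=
  (exists_sup_arrow S).choose_spec x y

theorem sup_arrow_ext {X Y : QSup Q} {f g : X ⟶ Y}
    (h : ∀ {p q : Q} (x : X.carrier.obj p) (y : Y.carrier.obj q),
      Y.carrier.hom (f.1.map x) y = Y.carrier.hom (g.1.map x) y) : f = g :=
  Subtype.ext (QFunctor.ext' fun x => Y.separated _ _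
    (by unfold QCat.le; rw [h]; exact Y.carrier.id_le _) (by unfold QCat.le; rw [← h]; exact Y.carrier.id_le _))

/-- The quantaloid `Q-Sup` of separated complete `Q`-categories and left adjoint functors, ordered
pointwise. -/
noncomputable instance supQuantaloid : Quantaloid (QSup Q) where
  homLattice X Y := completeLatticeOfSup (X ⟶ Y) fun S => by
    constructor
    · intro f hf q x
      have h := Y.carrier.id_le ((sSup S).1.map x)
      rw [sup_sSup_hom] at h
      exact h.trans (iInf_le (fun f : S => Y.carrier.hom (f.1.1.map x) ((sSup S).1.map x)) ⟨f, hf⟩)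
    · intro g hg q x
      change 𝟙 q ≤ Y.carrier.hom ((sSup S).1.map x) (g.1.map x)
      rw [sup_sSup_hom]
      exact le_iInf fun f => hg f.2 _ x
  sSup_comp {X Y Z} S g := sup_arrow_ext fun {p q} x z => by
    obtain ⟨g', hg⟩ := g.2
    rw [sup_sSup_hom]
    change Z.carrier.hom (g.1.map ((sSup S).1.map x)) z = _
    rw [hg, sup_sSup_hom]
    refine le_antisymm (le_iInf ?_) (le_iInf fun f => ?_)
    · rintro ⟨_, f, hf, rfl⟩
      refine iInf_le_of_le ⟨f, hf⟩ ?_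
      rw [← hg]; exact le_rfl
    · refine iInf_le_of_le ⟨_, f.1, f.2, rfl⟩ ?_
      rw [← hg]; exact le_rfl
  comp_sSup {X Y Z} f S := sup_arrow_ext fun {p q} x z => by
    rw [sup_sSup_hom]
    change Z.carrier.hom ((sSup S).1.map (f.1.map x)) z = _
    rw [sup_sSup_hom]
    refine le_antisymm (le_iInf ?_) (le_iInf fun g => ?_)
    · rintro ⟨_, g, hg, rfl⟩
      exact iInf_le_of_le ⟨g, hg⟩ le_rfl
    · exact iInf_le_of_le ⟨_, g.1, g.2, rfl⟩ le_rfl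

end Enriched

end Quantaloids

open Quantaloids

namespace Quantaloids

/-! ### Equivalences of quantaloids -/

section Equivalence

variable {C : Type w} [Category.{v} C] [Quantaloid C] {D : Type w'} [Category.{v} D] [Quantaloid D]

/-! The Girard hypothesis serves only to link diagonals with back diagonals; each side is then
matched with spaces over an arbitrary small quantaloid.

In a Girard quantaloid put `¬u = d ↙ u`. Then `¬u ↙ t = ¬(t ∘ u)` and, by cyclicity, `s ↘ ¬v = ¬(v ∘
s)`. As `¬` is injective, `v ∘ s = t ∘ u` holds exactly when `(t, s)` is a Chu connection from `¬u`
to `¬v`, and the two congruences correspond. Every arrow is a negation, so `D ≃ B`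
(`diag_equivalent_backDiag`). This applies to distributors because negating a distributor entry by
entry makes `Q-Dist` Girard (`isGirard_qdist`).

A distributor `φ` gives an interior operator `φ^* φ_*` (Kan) and a closure operator `μ ↦ (φ ↙ μ) ↘
φ` (Isbell) on presheaves over its domain. In both cases the second component of an arrow `(s, t)`
is forgotten: a distributor `s` is continuous exactly when some `t` completes it, and identifying
pairs amounts to identifying the `s` with the same effect on open presheaves, respectively with the
same closure. Every operator arises from the evaluation distributor `(x, μ) ↦ μ(x)` on its fixed
presheaves (`kanSpace_evalDist`, `isbellSpace_evalDist`). So both functors to spaces are full and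
surjective on objects, and quotienting by their kernels gives equivalences.

Finally, the closed presheaves of a closure space form a separated complete category, and a closed
continuous `ζ : X ⇸ Y` acts contravariantly by `μ ↦ c (μ ∘ ζ)`. A left adjoint is determined by its
values at closures of representables, which are the columns of such a `ζ`; and a separated complete
category is the category of closed presheaves for the operator `yoneda ∘ sup`. -/

theorem IsQuantaloidHom.comp {E : Type*} [Category.{v} E] [Quantaloid E] {F : C ⥤ D} {G : D ⥤ E}
    (hF : IsQuantaloidHom F) (hG : IsQuantaloidHom G) : IsQuantaloidHom (F ⋙ G) := fun S => by
  change G.map (F.map (sSup S)) = _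
  rw [hF, hG, Set.image_image]; rfl

theorem QuantaloidEquivalent.trans {E : Type*} [Category.{v} E] [Quantaloid E]
    (h : QuantaloidEquivalent C D) (h' : QuantaloidEquivalent D E) : QuantaloidEquivalent C E := by
  obtain ⟨F, hF, _⟩ := h
  obtain ⟨G, hG, _⟩ := h'
  exact ⟨F ⋙ G, hF.comp hG, inferInstance⟩

/-- `F` sends the inverse image of an arrow to its conjugate by the counit isomorphisms, and
composition on either side preserves joins; faithfulness of `F` then reflects the equality. -/
theorem QuantaloidEquivalent.symm (h : QuantaloidEquivalent C D) : QuantaloidEquivalent D C := by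
  obtain ⟨F, hF, _⟩ := h
  refine ⟨F.inv, fun S => F.map_injective ?_, inferInstance⟩
  rw [hF, Set.image_image]
  simp only [Functor.fun_inv_map]
  rw [Quantaloid.sSup_comp, Quantaloid.comp_sSup, Set.image_image]
  rfl

/-- A full and essentially surjective functor that reflects and preserves the order of arrows is an
equivalence of quantaloids. -/
theorem quantaloidEquivalent_of_map_le_map_iff (F : C ⥤ D)
    (hle : ∀ {p q : C} {f g : p ⟶ q}, F.map f ≤ F.map g ↔ f ≤ g)
    (hfull : ∀ {p q : C} (g : F.obj p ⟶ F.obj q), ∃ f, F.map f = g) (hess : F.EssSurj) :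
    QuantaloidEquivalent C D := by
  have : F.Full := ⟨fun g => hfull g⟩
  have : F.Faithful := ⟨fun h => le_antisymm (hle.1 h.le) (hle.1 h.ge)⟩
  refine ⟨F, fun {p q} S => ?_, { }⟩
  -- A preimage `f` of the join in `D` bounds `S` from above because the order is reflected, so no
  -- completeness argument is needed.
  obtain ⟨f, hf⟩ := hfull (sSup ((fun f => F.map f) '' S))
  refine le_antisymm ?_ (sSup_le ?_)
  · rw [← hf, hle]
    exact sSup_le fun g hg => hle.1 (hf ▸ le_sSup ⟨g, hg, rfl⟩)
  · rintro _ ⟨g, hg, rfl⟩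
    exact hle.2 (le_sSup hg)

/-- The functor on a quotient quantaloid induced by a functor that identifies congruent arrows. -/
def Congruence.lift (θ : Congruence C) (F : C ⥤ D)
    (h : ∀ {p q : C} (f g : p ⟶ q), (θ.rel p q).r f g → F.map f = F.map g) : θ.Quot ⥤ D where
  obj X := F.obj X.as
  map a := Quotient.lift (fun f => F.map f) h a
  map_id X := F.map_id X.as
  map_comp := by rintro X Y Z ⟨f⟩ ⟨g⟩; exact F.map_comp f g

/-- The functor to a quotient quantaloid. -/
def Congruence.proj (θ : Congruence C) : C ⥤ θ.Quot where
  obj X := ⟨X⟩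
  map f := θ.cls f

theorem Congruence.proj_isQuantaloidHom (θ : Congruence C) : IsQuantaloidHom θ.proj :=
  fun S => θ.cls_sSup S

/-- A full and essentially surjective homomorphism of quantaloids induces an equivalence on the
quotient by its kernel. -/
theorem quantaloidEquivalent_quot (θ : Congruence C) (F : C ⥤ D) (hF : IsQuantaloidHom F)
    (hθ : ∀ {p q : C} (f g : p ⟶ q), (θ.rel p q).r f g ↔ F.map f = F.map g)
    (hfull : ∀ {p q : C} (g : F.obj p ⟶ F.obj q), ∃ f, F.map f = g)
    (hess : ∀ d : D, ∃ c, F.obj c = d) : QuantaloidEquivalent θ.Quot D := by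
  have hfull : (θ.lift F fun f g => (hθ f g).1).Full := ⟨fun g => by
    obtain ⟨f, hf⟩ := hfull g
    exact ⟨θ.cls f, hf⟩⟩
  have hfaith : (θ.lift F fun f g => (hθ f g).1).Faithful := ⟨by
    rintro X Y ⟨f⟩ ⟨g⟩ h
    exact Quotient.sound ((hθ f g).2 h)⟩
  have hess : (θ.lift F fun f g => (hθ f g).1).EssSurj := ⟨fun d => by
    obtain ⟨c, hc⟩ := hess d
    exact ⟨⟨c⟩, ⟨eqToIso hc⟩⟩⟩
  refine ⟨θ.lift F fun f g => (hθ f g).1, fun {X Y} S => ?_, { }⟩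
  -- A join in the quotient is the class of the join of the largest representatives.
  change F.map (sSup (θ.rep '' S)) = _
  rw [hF, Set.image_image]
  congr 1
  refine Set.image_congr fun a _ => ?_
  conv_rhs => rw [← θ.cls_rep a]
  rfl

/-- The functor to the quantaloid of fixed arrows of a nucleus. -/
def QNucleus.proj (j : QNucleus C) : C ⥤ j.Fix where
  obj X := ⟨X⟩
  map f := ⟨j.cl f, j.idem f⟩
  map_comp f g := Subtype.ext (by
    change j.cl (f ≫ g) = j.cl (j.cl f ≫ j.cl g)
    rw [j.cl_comp_left, j.cl_comp_right])

theorem QNucleus.proj_isQuantaloidHom (j : QNucleus C) : IsQuantaloidHom j.proj :=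
  fun S => Subtype.ext (by
    change j.cl (sSup S) = j.cl (sSup _)
    rw [← j.cl_sSup_cl, Set.image_image]; rfl)

end Equivalence

/-! ### Girard quantaloids -/

section Girard

variable {C : Type w} [Category.{v} C] [Quantaloid C]

/-- A family of arrows is cyclic if `v ∘ u ≤ d` and `u ∘ v ≤ d` are equivalent. -/
def IsCyclic (d : ∀ q : C, q ⟶ q) : Prop :=
  ∀ {p q : C} (u : p ⟶ q) (v : q ⟶ p), u ≫ v ≤ d p ↔ v ≫ u ≤ d q

/-- Through the defining adjunctions, equality of the two implications into `d` is precisely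
cyclicity; the two negations then coincide, and both double-negation laws become the same one. -/
theorem isGirard_iff : IsGirard C ↔ ∃ d : ∀ q : C, q ⟶ q, IsCyclic d ∧
    ∀ {p q : C} (u : p ⟶ q), lda (d q) (lda (d p) u) = u := by
  constructor
  · rintro ⟨d, h, h'⟩
    refine ⟨d, fun u v => by rw [← le_lda_iff, h, le_rda_iff], fun u => ?_⟩
    rw [h, h, ← h u, (h' u).1]
  · rintro ⟨d, h, h'⟩
    have h1 : ∀ {p q : C} (u : p ⟶ q), lda (d p) u = rda u (d q) := fun u =>
      eq_of_forall_le_iff fun v => by rw [le_lda_iff, le_rda_iff, h]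
    exact ⟨d, h1, fun u => ⟨by rw [← h1, h'], by rw [← h1, h']⟩⟩

variable {d : ∀ q : C, q ⟶ q}

/-- Writing `¬u` for `d ↙ u`, one has `(¬u) ↙ s = ¬(s ∘ u)`. -/
theorem lda_neg {p q r : C} (u : p ⟶ q) (s : q ⟶ r) :
    lda (lda (d p) u) s = lda (d p) (u ≫ s) := by
  rw [lda_comp]

/-- In a Girard quantaloid, `t ↘ (¬u) = ¬(u ∘ t)`. -/
theorem IsCyclic.rda_neg (hd : IsCyclic d) {p q r : C} (u : p ⟶ q) (t : r ⟶ p) :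
    rda t (lda (d p) u) = lda (d r) (t ≫ u) :=
  eq_of_forall_le_iff fun v => by
    -- Cyclicity moves `t` from one end of the composite to the other.
    rw [le_rda_iff, le_lda_iff, le_lda_iff, Category.assoc, hd t, Category.assoc]

theorem neg_injective (hn : ∀ {p q : C} (u : p ⟶ q), lda (d q) (lda (d p) u) = u) {p q : C} :
    Function.Injective (fun u : p ⟶ q => lda (d p) u) := fun u v h => by
  rw [← hn u, ← hn v]; exact congrArg (lda (d q)) h

/-- The functor from arrows to back diagonals of a Girard quantaloid, `u ↦ ¬u`. -/
def negFunctor (hd : IsCyclic d) : Arrow C ⥤ ChuCon C where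
  obj u := ⟨lda (d u.left) u.hom⟩
  map {u v} f := ChuCon.Hom.mk f.right f.left (by
    rw [hd.rda_neg, lda_neg, Arrow.w])

theorem negFunctor_isQuantaloidHom (hd : IsCyclic d) : IsQuantaloidHom (negFunctor hd) :=
  fun S => ChuCon.Hom.ext
    (by change sSup _ = sSup _; rw [Set.image_image]; rfl)
    (by change sSup _ = sSup _; rw [Set.image_image]; rfl)

/-- The diagonals and the back diagonals of a Girard quantaloid form equivalent quantaloids. -/
theorem diag_equivalent_backDiag (h : IsGirard C) : QuantaloidEquivalent (Diag C) (BackDiag C) := by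
  obtain ⟨d, hd, hn⟩ := isGirard_iff.1 h
  refine quantaloidEquivalent_quot _ (negFunctor hd ⋙ (backDiagonalCongruence C).proj)
    (IsQuantaloidHom.comp (negFunctor_isQuantaloidHom hd) (Congruence.proj_isQuantaloidHom _)) ?_ ?_ ?_
  · intro u v f g
    have h1 : f.left ≫ v.hom = g.left ≫ v.hom ↔
        lda (lda (d u.left) u.hom) f.right = lda (lda (d u.left) u.hom) g.right := by
      rw [lda_neg, lda_neg, ← Arrow.w f, ← Arrow.w g]
      exact (neg_injective hn).eq_iff.symm
    exact h1.trans ⟨fun h => Quotient.sound h, fun h => Quotient.exact h⟩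
  · rintro u v ⟨f⟩
    -- Both sides of the Chu condition are negations, so injectivity of negation turns it back into
    -- a commuting square.
    have hw : ∀ (s : u.right ⟶ v.right) (t : u.left ⟶ v.left),
        lda (lda (d u.left) u.hom) s = rda t (lda (d v.left) v.hom) →
          u.hom ≫ s = t ≫ v.hom := fun s t h => by
      rw [lda_neg, hd.rda_neg] at h
      exact neg_injective hn h
    exact ⟨Arrow.homMk f.snd f.fst (hw f.fst f.snd f.w).symm, rfl⟩
  · rintro ⟨⟨u⟩⟩
    -- By double negation, `u` is the negation of `¬u`.
    refine ⟨Arrow.mk (lda (d _) u), ?_⟩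
    change (⟨⟨lda (d _) (lda (d _) u)⟩⟩ : BackDiag C) = _
    rw [hn]

end Girard

/-! ### The Girard structure on distributors -/

section DistGirard

variable {Q : Type u} [SmallCategory Q] [Quantaloid Q] {d : ∀ q : Q, q ⟶ q}

/-- The negation `(y, x) ↦ ¬φ(x, y)` of a distributor. -/
def negDist (hd : IsCyclic d) {X Y : QCat Q} (φ : X ⟶ Y) : Y ⟶ X :=
  { app := fun {p q} y x => lda (d q) (Dist.app φ x y)
    law := fun {p' p q q'} y' y x x' => by
      -- Cyclicity brings `X.hom x x'` to the front, next to `φ(x', y')`, where the distributor law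
      -- of `φ` applies.
      rw [le_lda_iff, ← Category.assoc, hd]
      have h : (X.hom x x' ≫ Dist.app φ x' y') ≫ Y.hom y' y ≤ Dist.app φ x y :=
        Dist.law φ x x' y' y
      have h' : Dist.app φ x y ≫ lda (d q) (Dist.app φ x y) ≤ d q := le_lda_iff.1 le_rfl
      simpa only [Category.assoc] using (comp_le_comp h le_rfl).trans h' : Dist Y X }

/-- The cyclic family of distributors induced by a cyclic family of arrows. -/
def cyclicDist (hd : IsCyclic d) (X : QCat Q) : X ⟶ X := negDist hd (𝟙 X)

/-- Only diagonal entries matter: an off-diagonal entry at `(x, x')` is closed up to a loop by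
`X.hom x' x`, which `φ` absorbs. The bound becomes entrywise, so cyclicity passes from `d` to
distributors. -/
theorem comp_le_cyclicDist_iff (hd : IsCyclic d) {X Y : QCat Q} (φ : X ⟶ Y) (ψ : Y ⟶ X) :
    φ ≫ ψ ≤ cyclicDist hd X ↔ ∀ {p q : Q} (x : X.obj p) (y : Y.obj q),
      Dist.app φ x y ≫ Dist.app ψ y x ≤ d p := by
  constructor
  · intro h p q x y
    have h1 : Dist.app φ x y ≫ Dist.app ψ y x ≤ lda (d p) (X.hom x x) :=
      (le_comp_app φ ψ x y x).trans (h _ _ x x)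
    refine le_trans ?_ (le_lda_iff.1 h1)
    conv_lhs => rw [← Category.id_comp (Dist.app φ x y ≫ Dist.app ψ y x)]
    exact comp_le_comp (X.id_le x) le_rfl
  · intro h p q x x'
    refine iSup₂_le fun r y => ?_
    change _ ≤ lda (d q) (X.hom x' x)
    rw [le_lda_iff, ← Category.assoc]
    exact (comp_le_comp (Dist.hom_app_le φ x' x y) le_rfl).trans (h x' y)

theorem isCyclic_cyclicDist (hd : IsCyclic d) : IsCyclic (cyclicDist hd) := fun {X Y} φ ψ => by
  rw [comp_le_cyclicDist_iff, comp_le_cyclicDist_iff]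
  exact ⟨fun h p q y x => (hd _ _).1 (h x y), fun h p q x y => (hd _ _).1 (h y x)⟩

/-- Negation in `Q-Dist` is computed entry by entry, so double negation is inherited from `Q`. -/
theorem lda_cyclicDist (hd : IsCyclic d) {X Y : QCat Q} (φ : X ⟶ Y) :
    lda (cyclicDist hd X) φ = negDist hd φ :=
  eq_of_forall_le_iff fun ψ => by
    rw [le_lda_iff, comp_le_cyclicDist_iff]
    exact ⟨fun h p q y x => le_lda_iff.2 (h x y), fun h p q x y => le_lda_iff.1 (h _ _ y x)⟩

/-- Distributors over a small Girard quantaloid form a Girard quantaloid. -/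
theorem isGirard_qdist (hQ : IsGirard Q) : IsGirard (QDist Q) := by
  obtain ⟨d, hd, hn⟩ := isGirard_iff.1 hQ
  refine isGirard_iff.2 ⟨cyclicDist hd, isCyclic_cyclicDist hd, fun φ => ?_⟩
  rw [lda_cyclicDist, lda_cyclicDist]
  exact Dist.ext fun x y => hn (Dist.app φ x y)

end DistGirard


/-! ### Presheaves fixed by an operator -/

section Presheaves

variable {Q : Type u} [SmallCategory Q] [Quantaloid Q]

/-- `PX(λ ∘ ζ, μ) = PY(λ, ζ_* μ)`, where `ζ_* μ = μ ↙ ζ`. -/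
theorem psh_hom_comp {X Y : QCat Q} (ζ : X ⟶ Y) {p q : Q} (ν : Y ⟶ pt p) (μ : X ⟶ pt q) :
    (Psh X).hom (ζ ≫ ν : X ⟶ pt p) μ = (Psh Y).hom ν (lda μ ζ : Y ⟶ pt q) := by
  change Dist.app (lda μ (ζ ≫ ν)) star star = Dist.app (lda (lda μ ζ) ν) star star
  rw [lda_comp]

theorem psh_hom_anti {X : QCat Q} {p q : Q} {μ μ' : X ⟶ pt p} {ν : X ⟶ pt q} (h : μ ≤ μ') :
    (Psh X).hom μ' ν ≤ (Psh X).hom μ ν :=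
  QCat.hom_eq_of_le (psh_le_iff.2 h) ν

/-- The Yoneda lemma. -/
theorem psh_hom_yoneda {X : QCat Q} {p q : Q} (x : X.obj p) (μ : X ⟶ pt q) :
    (Psh X).hom ((yoneda X).map x) μ = Dist.app μ x star :=
  eq_of_forall_le_iff fun f => by
    rw [le_psh_hom_iff]
    refine ⟨fun h => le_trans ?_ (h x), fun h r x' => ?_⟩
    · conv_lhs => rw [← Category.id_comp f]
      exact comp_le_comp (X.id_le x) le_rfl
    · exact (comp_le_comp le_rfl h).trans (Dist.hom_app_le μ x' x star)

/-- The right adjoint `φ_* : PX → PY`, `μ ↦ μ ↙ φ`, of the Kan adjunction of `φ : X ⇸ Y`. -/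
def kanRight {X Y : QCat Q} (φ : X ⟶ Y) : QFunctor (Psh X) (Psh Y) where
  map {q} μ := (lda μ φ : Y ⟶ pt q)
  hom_le {p q} μ ν := by
    have h := psh_hom_comp φ (lda μ φ : Y ⟶ pt p) ν
    exact (psh_hom_anti (le_lda_iff.1 le_rfl)).trans h.le

/-- The `Q`-category of presheaves fixed by an operator. -/
def fixedPsh {X : QCat Q} (c : QFunctor (Psh X) (Psh X)) : QCat Q where
  obj q := {μ : X ⟶ pt q // c.map μ = μ}
  hom μ ν := (Psh X).hom μ.1 ν.1
  id_le μ := (Psh X).id_le μ.1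
  comp_le μ ν ρ := (Psh X).comp_le μ.1 ν.1 ρ.1

/-- The inclusion of the presheaves fixed by an operator. -/
def fixedPshIncl {X : QCat Q} (c : QFunctor (Psh X) (Psh X)) : QFunctor (fixedPsh c) (Psh X) where
  map μ := μ.1
  hom_le _ _ := le_rfl

/-- The evaluation distributor `(x, μ) ↦ μ(x)` on fixed presheaves. -/
def evalDist {X : QCat Q} (c : QFunctor (Psh X) (Psh X)) : X ⟶ fixedPsh c :=
  ofTranspose (fixedPshIncl c)

theorem col_evalDist {X : QCat Q} (c : QFunctor (Psh X) (Psh X)) {q : Q}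
    (μ : (fixedPsh c).obj q) : (col (evalDist c) μ : X ⟶ pt q) = μ.1 :=
  congrArg (fun F : QFunctor (fixedPsh c) (Psh X) => F.map μ) (transpose_ofTranspose _)

/-- Taking a column becomes a composition in `Q-Dist`, so that columns can be handled by the
calculus of implications. -/
theorem col_eq_comp_yoneda {X Y : QCat Q} (φ : X ⟶ Y) {q : Q} (y : Y.obj q) :
    (col φ y : X ⟶ pt q) = φ ≫ ((yoneda Y).map y : Y ⟶ pt q) := by
  conv_lhs => rw [← Category.comp_id φ]
  exact col_comp φ (𝟙 Y) y

theorem dist_eq_of_col {X Y : QCat Q} {ζ η : X ⟶ Y}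
    (h : ∀ {q : Q} (y : Y.obj q), (col ζ y : X ⟶ pt q) = col η y) : ζ = η :=
  le_antisymm (dist_le_iff_col.2 fun y => (h y).le) (dist_le_iff_col.2 fun y => (h y).ge)

end Presheaves

/-! ### Diagonals and interior spaces -/

section Interior

variable {Q : Type u} [SmallCategory Q] [Quantaloid Q]

theorem QIntDist.map_le (X : QIntDist Q) {q : Q} (μ : X.carrier ⟶ pt q) :
    (X.int.map μ : X.carrier ⟶ pt q) ≤ μ :=
  psh_le_iff.1 (X.int_le _ μ)

theorem QIntDist.map_map (X : QIntDist Q) {q : Q} (μ : X.carrier ⟶ pt q) :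
    X.int.map (X.int.map μ) = X.int.map μ :=
  congrArg (fun F : QFunctor (Psh X.carrier) (Psh X.carrier) => F.map μ) X.int_int

theorem QIntDist.ext_int {X : QCat Q} {σ τ : QFunctor (Psh X) (Psh X)} {h₁ h₂ h₁' h₂'}
    (h : ∀ {q : Q} (μ : X ⟶ pt q), σ.map μ = τ.map μ) :
    (⟨X, σ, h₁, h₂⟩ : QIntDist Q) = ⟨X, τ, h₁', h₂'⟩ := by
  obtain rfl : σ = τ := QFunctor.ext' h
  rfl

/-- A triangle identity for the adjunction between `u ≫ -` and `lda - u`. For distributors it gives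
idempotency of `φ^* φ_*` and shows that presheaves `λ ∘ φ` are fixed by it. -/
theorem comp_lda_comp {C : Type w} [Category.{v} C] [Quantaloid C] {p q r : C} (u : p ⟶ q)
    (v : q ⟶ r) : u ≫ lda (u ≫ v) u = u ≫ v :=
  le_antisymm (le_lda_iff.1 le_rfl) (comp_le_comp le_rfl (le_lda_iff.2 le_rfl))

/-- The interior space on the domain of a distributor `φ`, with interior operator `φ^* φ_*`. -/
def kanSpace {X Y : QCat Q} (φ : X ⟶ Y) : QIntDist Q where
  carrier := X
  int := (kan φ).comp (kanRight φ)
  int_le _ _ := psh_le_iff.2 (le_lda_iff.1 le_rfl)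
  int_int := QFunctor.ext' fun {q} (μ : X ⟶ pt q) =>
    comp_lda_comp φ (lda μ φ : Y ⟶ pt q)

theorem isContinuous_kanSpace_iff {X Y X' Y' : QCat Q} {φ : X ⟶ Y} {ψ : X' ⟶ Y'} {s : X ⟶ X'} :
    IsContinuous (kanSpace φ).int (kanSpace ψ).int s ↔ ∀ {q : Q} (μ : X' ⟶ pt q),
      s ≫ ψ ≫ lda μ ψ ≤ φ ≫ lda (s ≫ μ) φ :=
  isContinuous_iff

variable (Q) in
/-- The functor `(s, t) ↦ s` from arrows of `Q-Dist` to interior spaces. -/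
def kanSpaceFunctor : Arrow (QDist Q) ⥤ QIntDist Q where
  obj u := kanSpace u.hom
  map {u v} f := ⟨f.left, isContinuous_kanSpace_iff.2 fun {q} μ => by
    -- The commuting square factors the left side through `u.hom`, and the remaining factor lies
    -- below the implication by the same square read backwards.
    rw [← Category.assoc, Arrow.w, Category.assoc]
    refine comp_le_comp le_rfl (le_lda_iff.2 ?_)
    rw [← Category.assoc, ← Arrow.w, Category.assoc]
    exact comp_le_comp le_rfl (le_lda_iff.1 le_rfl)⟩

theorem kanSpaceFunctor_isQuantaloidHom : IsQuantaloidHom (kanSpaceFunctor Q) :=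
  fun S => Subtype.ext (by change sSup _ = sSup _; rw [Set.image_image]; rfl)

/-- The operator of `v.hom` takes values of the form `λ ∘ v.hom`, on which `f` and `g` agree if
their diagonals do. Conversely, the columns of `v.hom` are fixed by the operator, and evaluating
there recovers the columns of the diagonals. -/
theorem kanSpaceFunctor_rel_iff {u v : Arrow (QDist Q)} (f g : u ⟶ v) :
    f.left ≫ v.hom = g.left ≫ v.hom ↔
      (kan f.left).comp (kanSpace v.hom).int = (kan g.left).comp (kanSpace v.hom).int := by
  constructor
  · intro h
    refine QFunctor.ext' fun {q} (μ : v.left ⟶ pt q) => ?_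
    change (f.left ≫ v.hom ≫ (lda μ v.hom : _ ⟶ pt q) : _ ⟶ pt q) =
      g.left ≫ v.hom ≫ (lda μ v.hom : _ ⟶ pt q)
    rw [← Category.assoc, h, Category.assoc]
  · intro h
    refine dist_eq_of_col fun {q} y => ?_
    have h1 : ((kan f.left).comp (kanSpace v.hom).int).map (col v.hom y) =
        ((kan g.left).comp (kanSpace v.hom).int).map (col v.hom y) := by rw [h]
    change (f.left ≫ v.hom ≫ (lda (col v.hom y : v.left ⟶ pt q) v.hom : _ ⟶ pt q) : _ ⟶ pt q) =
      g.left ≫ v.hom ≫ (lda (col v.hom y : v.left ⟶ pt q) v.hom : _ ⟶ pt q) at h1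
    rw [col_eq_comp_yoneda v.hom, comp_lda_comp, ← col_eq_comp_yoneda] at h1
    rw [col_comp, col_comp, h1]

/-- Continuity, tested at the columns of `v.hom`, says that the columns of `s ≫ v.hom` are fixed by
the Kan operator of `u.hom`. Hence this diagonal factors through `u.hom`, and the second component
consists of the implications of its columns by `u.hom`. -/
theorem exists_kanSpaceFunctor_map {u v : Arrow (QDist Q)}
    (s : kanSpace u.hom ⟶ kanSpace v.hom) : ∃ f : u ⟶ v, (kanSpaceFunctor Q).map f = s := by
  let w : u.left ⟶ v.right := s.1 ≫ v.hom
  have hw : u.hom ≫ ofTranspose ((kanRight u.hom).comp (transpose w)) = w := by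
    refine dist_eq_of_col fun {q} y => ?_
    have h1 : (col (ofTranspose ((kanRight u.hom).comp (transpose w))) y : u.right ⟶ pt q) =
        lda (col w y : u.left ⟶ pt q) u.hom :=
      congrArg (fun F : QFunctor v.right (Psh u.right) => F.map y) (transpose_ofTranspose _)
    rw [col_comp, h1]
    refine le_antisymm (le_lda_iff.1 le_rfl) ?_
    have h2 := isContinuous_kanSpace_iff.1 s.2 (col v.hom y : v.left ⟶ pt q)
    have h3 : v.hom ≫ lda (col v.hom y : v.left ⟶ pt q) v.hom = col v.hom y := by
      rw [col_eq_comp_yoneda v.hom, comp_lda_comp]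
    have h4 : (col w y : u.left ⟶ pt q) = s.1 ≫ (col v.hom y : v.left ⟶ pt q) :=
      col_comp s.1 v.hom y
    rw [h3] at h2
    rw [h4]
    exact h2
  exact ⟨Arrow.homMk s.1 _ hw.symm, rfl⟩

/-- A composite with `φ` is a weighted join of columns of `φ`; since `σ` is a `Q`-functor, fixing
the columns forces it to be increasing on such joins. -/
theorem comp_le_map_comp {X Y : QCat Q} (σ : QFunctor (Psh X) (Psh X)) {φ : X ⟶ Y}
    (hφ : IsClosedDist σ φ) {q : Q} (μ : Y ⟶ pt q) :
    (φ ≫ μ : X ⟶ pt q) ≤ σ.map (φ ≫ μ : X ⟶ pt q) := by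
  conv_lhs => rw [← distClosure_eq_iff.2 hφ]
  exact distClosure_comp_le σ φ μ

theorem isClosedDist_evalDist {X : QCat Q} (σ : QFunctor (Psh X) (Psh X)) :
    IsClosedDist σ (evalDist σ) := fun μ => by
  rw [show col (evalDist σ) μ = μ.1 from col_evalDist σ μ]; exact μ.2

/-- The Kan operator sends `μ` to the largest presheaf below `μ` that is a weighted join of open
presheaves. It lies below `σ μ` by `comp_le_map_comp`, and `σ μ` is itself open, hence a column of
the evaluation distributor. -/
theorem kanSpace_evalDist (X : QIntDist Q) : kanSpace (evalDist X.int) = X := by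
  obtain ⟨X, σ, h₁, h₂⟩ := X
  have h3 : ∀ {q : Q} (μ : X ⟶ pt q), evalDist σ ≫ lda μ (evalDist σ) = σ.map μ := fun {q} μ => by
    have h4 : evalDist σ ≫ lda μ (evalDist σ) ≤ μ := le_lda_iff.1 le_rfl
    refine le_antisymm ((comp_le_map_comp σ (isClosedDist_evalDist σ) _).trans (op_mono σ h4)) ?_
    let ν : (fixedPsh σ).obj q := ⟨σ.map μ, QIntDist.map_map ⟨X, σ, h₁, h₂⟩ μ⟩
    have h5 : evalDist σ ≫ ((yoneda _).map ν : _ ⟶ pt q) = σ.map μ :=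
      (col_eq_comp_yoneda _ ν).symm.trans (col_evalDist σ ν)
    rw [← h5]
    refine comp_le_comp le_rfl (le_lda_iff.2 ?_)
    rw [h5]
    exact QIntDist.map_le ⟨X, σ, h₁, h₂⟩ μ
  exact QIntDist.ext_int h3

variable (Q) in
theorem diag_equivalent_intDistO : QuantaloidEquivalent (Diag (QDist Q)) (QIntDistO Q) := by
  refine quantaloidEquivalent_quot _ (kanSpaceFunctor Q ⋙ (openCongruence Q).proj)
    (IsQuantaloidHom.comp kanSpaceFunctor_isQuantaloidHom (Congruence.proj_isQuantaloidHom _))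
    ?_ ?_ ?_
  · intro u v f g
    exact (kanSpaceFunctor_rel_iff f g).trans
      ⟨fun h => Quotient.sound h, fun h => Quotient.exact h⟩
  · rintro u v ⟨s⟩
    obtain ⟨f, hf⟩ := exists_kanSpaceFunctor_map s
    exact ⟨f, congrArg (Quotient.mk _) hf⟩
  · rintro ⟨X⟩
    exact ⟨Arrow.mk (evalDist X.int), congrArg Congruence.Quot.of (kanSpace_evalDist X)⟩

end Interior


/-! ### Adjoint arrows in a quantaloid -/

section Adjoint

variable {C : Type w} [Category.{v} C] [Quantaloid C]

theorem le_rda_lda {p q r : C} (w : p ⟶ r) (u : p ⟶ q) : u ≤ rda (lda w u) w :=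
  le_rda_iff.2 (le_lda_iff.1 le_rfl)

theorem le_lda_rda {p q r : C} (w : p ⟶ r) (v : q ⟶ r) : v ≤ lda w (rda v w) :=
  le_lda_iff.2 (le_rda_iff.1 le_rfl)

theorem lda_anti {p q r : C} (w : p ⟶ r) {u u' : p ⟶ q} (h : u ≤ u') : lda w u' ≤ lda w u :=
  le_lda_iff.2 ((comp_le_comp h le_rfl).trans (le_lda_iff.1 le_rfl))

theorem rda_anti {p q r : C} (w : p ⟶ r) {v v' : q ⟶ r} (h : v ≤ v') : rda v' w ≤ rda v w :=
  le_rda_iff.2 ((comp_le_comp le_rfl h).trans (le_rda_iff.1 le_rfl))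

theorem rda_lda_rda {p q r : C} (w : p ⟶ r) (v : q ⟶ r) : rda (lda w (rda v w)) w = rda v w :=
  le_antisymm (rda_anti w (le_lda_rda w v)) (le_rda_lda w _)

theorem lda_rda_lda {p q r : C} (w : p ⟶ r) (u : p ⟶ q) : lda w (rda (lda w u) w) = lda w u :=
  le_antisymm (lda_anti w (le_rda_lda w u)) (le_lda_rda w _)

variable {y p : C} {c : y ⟶ p} {r : p ⟶ y}

/-- The hypotheses say `r ⊣ c` in the quantaloid, so composition with `c` and with `r` are adjoint
on hom-sets. The intended instance is `r = Y(y, -)` and `c = Y(-, y)`, where composing with `c`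
takes the column at `y`. -/
theorem comp_le_iff_of_adjoint (h₁ : 𝟙 p ≤ r ≫ c) (h₂ : c ≫ r ≤ 𝟙 y) {z : C} {v : p ⟶ z}
    {f : y ⟶ z} : c ≫ v ≤ f ↔ v ≤ r ≫ f := by
  constructor
  · intro h
    refine le_trans ?_ (comp_le_comp le_rfl h)
    rw [← Category.assoc]
    conv_lhs => rw [← Category.id_comp v]
    exact comp_le_comp h₁ le_rfl
  · intro h
    refine (comp_le_comp le_rfl h).trans ?_
    rw [← Category.assoc]
    conv_rhs => rw [← Category.id_comp f]
    exact comp_le_comp h₂ le_rfl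

theorem le_comp_iff_of_adjoint (h₁ : 𝟙 p ≤ r ≫ c) (h₂ : c ≫ r ≤ 𝟙 y) {x : C} {g : x ⟶ p}
    {f : x ⟶ y} : g ≫ r ≤ f ↔ g ≤ f ≫ c := by
  constructor
  · intro h
    refine le_trans ?_ (comp_le_comp h le_rfl)
    rw [Category.assoc]
    conv_lhs => rw [← Category.comp_id g]
    exact comp_le_comp le_rfl h₁
  · intro h
    refine (comp_le_comp h le_rfl).trans ?_
    rw [Category.assoc]
    conv_rhs => rw [← Category.comp_id f]
    exact comp_le_comp le_rfl h₂

theorem lda_comp_of_adjoint (h₁ : 𝟙 p ≤ r ≫ c) (h₂ : c ≫ r ≤ 𝟙 y) {x z : C} (u : x ⟶ z)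
    (s : x ⟶ y) : lda u (s ≫ c) = r ≫ lda u s :=
  eq_of_forall_le_iff fun v => by
    rw [le_lda_iff, ← comp_le_iff_of_adjoint h₁ h₂, le_lda_iff, Category.assoc]

theorem rda_comp_of_adjoint (h₁ : 𝟙 p ≤ r ≫ c) (h₂ : c ≫ r ≤ 𝟙 y) {x z : C} (u : x ⟶ z)
    (f : y ⟶ z) : rda (r ≫ f) u = rda f u ≫ c :=
  eq_of_forall_le_iff fun v => by
    rw [le_rda_iff, ← le_comp_iff_of_adjoint h₁ h₂, le_rda_iff, Category.assoc]

theorem lda_comp_right_of_adjoint (h₁ : 𝟙 p ≤ r ≫ c) (h₂ : c ≫ r ≤ 𝟙 y) {x z : C} (u : x ⟶ y)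
    (s : x ⟶ z) : lda (u ≫ c) s = lda u s ≫ c :=
  eq_of_forall_le_iff fun v => by
    rw [le_lda_iff, ← le_comp_iff_of_adjoint h₁ h₂, ← le_comp_iff_of_adjoint h₁ h₂, le_lda_iff,
      Category.assoc]

theorem rda_eq_comp_of_adjoint (h₁ : 𝟙 p ≤ r ≫ c) (h₂ : c ≫ r ≤ 𝟙 y) {x : C} (u : x ⟶ y) :
    rda r u = u ≫ c :=
  eq_of_forall_le_iff fun v => by rw [le_rda_iff, ← le_comp_iff_of_adjoint h₁ h₂]

end Adjoint

/-! ### Back diagonals and closure spaces -/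

section Closure

variable {Q : Type u} [SmallCategory Q] [Quantaloid Q]

/-- The copresheaf `Y(y, -)` represented by an element. -/
def coyoneda {Y : QCat Q} {q : Q} (y : Y.obj q) : pt q ⟶ Y :=
  { app := fun s y' => match s with
      | .star => Y.hom y y'
    law := by
      rintro _ _ _ _ ⟨⟩ ⟨⟩ y' y''
      change (𝟙 _ ≫ Y.hom y y') ≫ Y.hom y' y'' ≤ Y.hom y y''
      rw [Category.id_comp]
      exact Y.comp_le _ _ _ : Dist (pt q) Y }

/-- Together with `comp_coyoneda_le` this gives the adjunction `Y(y, -) ⊣ Y(-, y)` in `Q-Dist`. -/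
theorem id_le_coyoneda_comp {Y : QCat Q} {q : Q} (y : Y.obj q) :
    𝟙 (pt q) ≤ coyoneda y ≫ ((yoneda Y).map y : Y ⟶ pt q) := by
  rintro _ _ ⟨⟩ ⟨⟩
  refine le_trans ?_ (le_comp_app (coyoneda y) ((yoneda Y).map y : Y ⟶ pt q) star y star)
  change 𝟙 q ≤ Y.hom y y ≫ Y.hom y y
  conv_lhs => rw [← Category.comp_id (𝟙 q)]
  exact comp_le_comp (Y.id_le y) (Y.id_le y)

theorem comp_coyoneda_le {Y : QCat Q} {q : Q} (y : Y.obj q) :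
    ((yoneda Y).map y : Y ⟶ pt q) ≫ coyoneda y ≤ 𝟙 Y := by
  intro p r x x'
  refine iSup₂_le ?_
  rintro _ ⟨⟩
  exact Y.comp_le x y x'

/-- Turns a bound on a hom-arrow of `PX` into an inequality in `Q-Dist`, which makes functoriality
of the Isbell operator a computation with implications. -/
theorem le_psh_hom_iff_comp_arrowDist {X : QCat Q} {p q : Q} {μ : X ⟶ pt p} {ν : X ⟶ pt q}
    {f : p ⟶ q} : f ≤ (Psh X).hom μ ν ↔ μ ≫ arrowDist f ≤ ν := by
  rw [le_psh_hom_iff]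
  refine ⟨fun h => ptDist_le_iff.2 fun x => ?_, fun h r x => ?_⟩
  · refine iSup₂_le ?_
    rintro _ ⟨⟩
    exact h x
  · exact (le_comp_app μ (arrowDist f) x star star).trans (ptDist_le_iff.1 h x)

/-- The closure operator `μ ↦ (φ ↙ μ) ↘ φ` of the Isbell adjunction of a distributor. -/
def isbell {X Y : QCat Q} (φ : X ⟶ Y) : QFunctor (Psh X) (Psh X) where
  map {q} μ := (rda (lda φ μ) φ : X ⟶ pt q)
  hom_le {p q} μ ν := by
    rw [le_psh_hom_iff_comp_arrowDist, le_rda_iff, Category.assoc]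
    have h : μ ≫ arrowDist ((Psh X).hom μ ν) ≤ ν := le_psh_hom_iff_comp_arrowDist.1 le_rfl
    refine (comp_le_comp le_rfl (le_lda_iff.2 ?_)).trans (le_rda_iff.1 le_rfl)
    rw [← Category.assoc]
    exact (comp_le_comp h le_rfl).trans (le_lda_iff.1 le_rfl)

/-- The closure space on the domain of a distributor, given by its Isbell adjunction. -/
def isbellSpace {X Y : QCat Q} (φ : X ⟶ Y) : QClsDist Q where
  carrier := X
  cls := isbell φ
  le_cls _ _ := psh_le_iff.2 (le_rda_lda φ _)
  cls_cls := QFunctor.ext' fun _ => rda_lda_rda φ _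

theorem isContinuous_isbell_iff {X Y X' Y' : QCat Q} {φ : X ⟶ Y} {ψ : X' ⟶ Y'} {s : X ⟶ X'} :
    IsContinuous (isbell φ) (isbell ψ) s ↔ ∀ {q : Q} (μ : X' ⟶ pt q),
      s ≫ rda (lda ψ μ) ψ ≤ rda (lda φ (s ≫ μ)) φ :=
  isContinuous_iff

/-- By the Chu condition, `φ ↙ (μ ∘ s) = (t ↘ ψ) ↙ μ = t ↘ (ψ ↙ μ)`; what remains is two evaluations
of implications. -/
theorem isContinuous_isbell {X Y X' Y' : QCat Q} {φ : X ⟶ Y} {ψ : X' ⟶ Y'} {s : X ⟶ X'}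
    {t : Y ⟶ Y'} (h : lda φ s = rda t ψ) : IsContinuous (isbell φ) (isbell ψ) s :=
  isContinuous_isbell_iff.2 fun μ => by
    rw [le_rda_iff, Category.assoc, lda_comp, h, ← le_lda_iff, h, rda_lda, le_rda_iff,
      Category.assoc]
    exact (comp_le_comp le_rfl (le_rda_iff.1 le_rfl)).trans (le_rda_iff.1 le_rfl)

/-- Taking a column is composition with a right adjoint, and both implications are compatible with
it; so the columnwise closure is the Isbell formula applied to the whole distributor. -/
theorem distClosure_isbell {X Y Z : QCat Q} (φ : X ⟶ Y) (s : X ⟶ Z) :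
    distClosure (isbell φ) s = rda (lda φ s) φ := by
  refine dist_eq_of_col fun {q} z => ?_
  have h₁ := id_le_coyoneda_comp z
  have h₂ := comp_coyoneda_le z
  have h₃ : (col (distClosure (isbell φ) s) z : X ⟶ pt q) =
      rda (lda φ (col s z : X ⟶ pt q)) φ := col_distClosure _ _ _
  rw [h₃, col_eq_comp_yoneda, col_eq_comp_yoneda, lda_comp_of_adjoint h₁ h₂,
    rda_comp_of_adjoint h₁ h₂]

variable (Q) in
/-- The functor `(s, t) ↦ s` from arrows of `Q-Dist` to closure spaces. -/
def isbellSpaceFunctor : ChuCon (QDist Q) ⥤ QClsDist Q where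
  obj u := isbellSpace u.arr
  map f := ⟨ChuCon.Hom.fst f, isContinuous_isbell (ChuCon.Hom.w f)⟩

theorem isbellSpaceFunctor_isQuantaloidHom : IsQuantaloidHom (isbellSpaceFunctor Q) :=
  fun S => Subtype.ext (by change sSup _ = sSup _; rw [Set.image_image]; rfl)

/-- By a triangle identity, `φ ↙ s` and its closure `(φ ↙ s) ↘ φ` determine each other. This
identifies the back diagonal congruence with the kernel of closure. -/
theorem lda_eq_lda_iff_distClosure_eq {X Y Z : QCat Q} (φ : X ⟶ Y) (s s' : X ⟶ Z) :
    lda φ s = lda φ s' ↔ distClosure (isbell φ) s = distClosure (isbell φ) s' := by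
  rw [distClosure_isbell, distClosure_isbell]
  exact ⟨fun h => by rw [h], fun h => by rw [← lda_rda_lda, h, lda_rda_lda]⟩

/-- The first component of a Chu connection can be any continuous distributor. -/
theorem lda_eq_rda_of_isContinuous {X Y X' Y' : QCat Q} {φ : X ⟶ Y} {ψ : X' ⟶ Y'} {s : X ⟶ X'}
    (hs : IsContinuous (isbell φ) (isbell ψ) s) : lda φ s = rda (lda ψ (lda φ s)) ψ := by
  -- The claim is that the columns of `φ ↙ s` are closed for `ψ`, which makes `ψ ↙ (φ ↙ s)` a valid
  -- second component.
  rw [← distClosure_isbell, eq_comm, distClosure_eq_iff]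
  intro q y
  have h₁ := id_le_coyoneda_comp y
  have h₂ := comp_coyoneda_le y
  have h₃ : (col (lda φ s) y : X' ⟶ pt q) = lda (rda (coyoneda y) φ) s := by
    rw [col_eq_comp_yoneda, rda_eq_comp_of_adjoint h₁ h₂, lda_comp_right_of_adjoint h₁ h₂]
  rw [h₃]
  refine le_antisymm (α := X' ⟶ pt q) (le_lda_iff.2 ?_) (le_rda_lda ψ _)
  refine (isContinuous_isbell_iff.1 hs _).trans ?_
  -- The column `φ(-, y) = Y(y, -) ↘ φ` is Isbell closed, so the closure supplied by continuity is
  -- absorbed.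
  rw [← rda_lda_rda φ (coyoneda y)]
  refine rda_anti φ (lda_anti φ (le_lda_iff.1 ?_))
  rw [rda_lda_rda]

theorem QClsDist.ext_cls {X : QCat Q} {c d : QFunctor (Psh X) (Psh X)} {h₁ h₂ h₁' h₂'}
    (h : ∀ {q : Q} (μ : X ⟶ pt q), c.map μ = d.map μ) :
    (⟨X, c, h₁, h₂⟩ : QClsDist Q) = ⟨X, d, h₁', h₂'⟩ := by
  obtain rfl : c = d := QFunctor.ext' h
  rfl

/-- `PX(c μ, ν) = PX(μ, ν)` if `ν` is closed. -/
theorem QClsDist.hom_cls (X : QClsDist Q) {p q : Q} (μ : X.carrier ⟶ pt p)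
    {ν : X.carrier ⟶ pt q} (hν : X.cls.map ν = ν) :
    (Psh X.carrier).hom (X.cls.map μ) ν = (Psh X.carrier).hom μ ν := by
  refine le_antisymm (psh_hom_anti (X.le_map μ)) ?_
  conv_rhs => rw [← hν]
  exact X.cls.hom_le μ ν

/-- The presheaf `c μ` is a column of the evaluation distributor, hence Isbell closed, and lies
above `μ`: this bounds the Isbell closure of `μ`. Conversely, homs from `μ` and from `c μ` into
closed presheaves agree, so `c μ` satisfies every constraint defining that closure. -/
theorem isbellSpace_evalDist (X : QClsDist Q) : isbellSpace (evalDist X.cls) = X := by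
  obtain ⟨X, c, h₁, h₂⟩ := X
  let S : QClsDist Q := ⟨X, c, h₁, h₂⟩
  have h₃ : ∀ {q : Q} (μ : X ⟶ pt q), rda (lda (evalDist c) μ) (evalDist c) = c.map μ := by
    intro q μ
    apply le_antisymm
    · let ν : (fixedPsh c).obj q := ⟨c.map μ, S.map_map μ⟩
      have h₄ : rda (coyoneda ν) (evalDist c) = c.map μ :=
        (rda_eq_comp_of_adjoint (id_le_coyoneda_comp ν) (comp_coyoneda_le ν) _).trans
          ((col_eq_comp_yoneda _ ν).symm.trans (col_evalDist c ν))
      rw [← h₄]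
      refine rda_anti _ (le_lda_iff.2 (le_rda_iff.1 ?_))
      rw [h₄]
      exact S.le_map μ
    · rw [le_rda_iff]
      intro p r x ν
      refine iSup₂_le ?_
      rintro _ ⟨⟩
      refine le_trans (comp_le_comp le_rfl ?_) (le_psh_hom_iff.1 (le_refl ((Psh X).hom (c.map μ) ν.1)) x)
      rw [S.hom_cls μ ν.2, le_psh_hom_iff]
      intro r x
      exact (le_comp_app μ (lda (evalDist c) μ) x star ν).trans
        ((le_lda_iff (w := evalDist c)).1 le_rfl _ _ x ν)
  exact QClsDist.ext_cls h₃

variable (Q) in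
theorem backDiag_equivalent_clsCloDist :
    QuantaloidEquivalent (BackDiag (QDist Q)) (QClsCloDist Q) := by
  refine quantaloidEquivalent_quot _ (isbellSpaceFunctor Q ⋙ (closureNucleus Q).proj)
    (IsQuantaloidHom.comp isbellSpaceFunctor_isQuantaloidHom (QNucleus.proj_isQuantaloidHom _))
    ?_ ?_ ?_
  · intro u v f g
    refine (lda_eq_lda_iff_distClosure_eq u.arr f.fst g.fst).trans ?_
    exact ⟨fun h => Subtype.ext (Subtype.ext h),
      fun h => congrArg Subtype.val (congrArg Subtype.val h)⟩
  · intro u v ζ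
    exact ⟨ChuCon.Hom.mk ζ.1.1 _ (lda_eq_rda_of_isContinuous ζ.1.2), Subtype.ext ζ.2⟩
  · rintro ⟨X⟩
    exact ⟨⟨evalDist X.cls⟩, congrArg QNucleus.Fix.of (isbellSpace_evalDist X)⟩

end Closure


/-! ### Closure spaces and complete categories -/

section Complete

variable {Q : Type u} [SmallCategory Q] [Quantaloid Q]

namespace QClsDist

/-- The presheaf `c μ`, as a closed presheaf. -/
def closed (X : QClsDist Q) {q : Q} (μ : X.carrier ⟶ pt q) : (fixedPsh X.cls).obj q :=
  ⟨X.cls.map μ, X.map_map μ⟩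

/-- The reflection of presheaves into closed presheaves. -/
def reflect (X : QClsDist Q) : QFunctor (Psh X.carrier) (fixedPsh X.cls) where
  map μ := X.closed μ
  hom_le μ ν := X.cls.hom_le μ ν

theorem reflect_adj (X : QClsDist Q) : X.reflect.Adj (fixedPshIncl X.cls) :=
  fun μ ν => X.hom_cls μ ν.2

theorem isSeparated_fixedPsh (X : QClsDist Q) : (fixedPsh X.cls).IsSeparated :=
  fun _ _ h h' => Subtype.ext (le_antisymm (psh_le_iff.1 h) (psh_le_iff.1 h'))

/-- The presheaf `⋁ μ, Φ(μ) ∘ μ` has the universal property of a weighted colimit. -/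
theorem psh_hom_evalDist_comp (X : QClsDist Q) {p q : Q} (Φ : fixedPsh X.cls ⟶ pt p)
    (ν : (fixedPsh X.cls).obj q) :
    (Psh X.carrier).hom (evalDist X.cls ≫ Φ : X.carrier ⟶ pt p) ν.1 =
      (Psh (fixedPsh X.cls)).hom Φ ((yoneda _).map ν) := by
  rw [psh_hom_comp]
  refine eq_of_forall_le_iff fun f => ?_
  rw [le_psh_hom_iff, le_psh_hom_iff]
  -- By Yoneda, `ν ↙ evalDist` is the presheaf represented by `ν` on the closed presheaves.
  have h : ∀ {r : Q} (μ : (fixedPsh X.cls).obj r),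
      Dist.app (lda ν.1 (evalDist X.cls)) μ star = (fixedPsh X.cls).hom μ ν := fun {r} μ => by
    rw [← psh_hom_yoneda (X := fixedPsh X.cls) μ, ← psh_hom_comp, ← col_eq_comp_yoneda,
      col_evalDist]
    rfl
  exact forall₂_congr fun r μ => by rw [h]; rfl

/-- Suprema of closed presheaves are closures of the weighted colimits formed in `PX`. -/
theorem isComplete_fixedPsh (X : QClsDist Q) : (fixedPsh X.cls).IsComplete :=
  ⟨X.reflect.comp (kan (evalDist X.cls)), fun Φ ν =>
    (X.reflect_adj _ ν).trans (X.psh_hom_evalDist_comp Φ ν)⟩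

/-- The complete category of closed presheaves of a closure space. -/
def toSup (X : QClsDist Q) : QSup Q := ⟨fixedPsh X.cls, X.isSeparated_fixedPsh, X.isComplete_fixedPsh⟩

variable {X Y : QClsDist Q}

/-- The functor `μ ↦ c (μ ∘ ζ)` between the categories of closed presheaves. -/
def pullback (X : QClsDist Q) {Y : QClsDist Q} (ζ : X.carrier ⟶ Y.carrier) :
    QFunctor (fixedPsh Y.cls) (fixedPsh X.cls) :=
  X.reflect.comp ((kan ζ).comp (fixedPshIncl Y.cls))

/-- The right adjoint of a continuous distributor preserves closed presheaves. -/
theorem cls_lda {ζ : X.carrier ⟶ Y.carrier} (hζ : IsContinuous X.cls Y.cls ζ) {q : Q}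
    {μ : X.carrier ⟶ pt q} (hμ : X.cls.map μ = μ) :
    Y.cls.map (lda μ ζ : Y.carrier ⟶ pt q) = lda μ ζ := by
  refine le_antisymm (α := Y.carrier ⟶ pt q) (le_lda_iff.2 ?_) (Y.le_map _)
  refine (isContinuous_iff.1 hζ _).trans ?_
  conv_rhs => rw [← hμ]
  exact op_mono X.cls (le_lda_iff.1 le_rfl)

/-- The right adjoint is `μ ↦ μ ↙ ζ`; continuity ensures that it preserves closed presheaves. -/
theorem isLeftAdj_pullback {ζ : X.carrier ⟶ Y.carrier} (hζ : IsContinuous X.cls Y.cls ζ) :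
    (X.pullback ζ).IsLeftAdj :=
  ⟨⟨fun μ => ⟨lda μ.1 ζ, cls_lda hζ μ.2⟩, fun μ ν => (kanRight ζ).hom_le μ.1 ν.1⟩, fun μ ν =>
    (X.reflect_adj _ ν).trans (psh_hom_comp ζ μ.1 ν.1)⟩

/-- A continuous distributor, as an arrow between complete categories of closed presheaves. -/
def toSupMap (ζ : X ⟶ Y) : Y.toSup ⟶ X.toSup :=
  ⟨X.pullback ζ.1, isLeftAdj_pullback ζ.2⟩

theorem cls_distClosure_comp (ζ : X.carrier ⟶ Y.carrier) {q : Q} (μ : Y.carrier ⟶ pt q) :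
    X.cls.map (distClosure X.cls ζ ≫ μ : X.carrier ⟶ pt q) =
      X.cls.map (ζ ≫ μ : X.carrier ⟶ pt q) := by
  refine le_antisymm (α := X.carrier ⟶ pt q) ?_
    (op_mono X.cls (comp_le_comp (X.le_distClosure ζ) le_rfl))
  conv_rhs => rw [← X.map_map]
  exact op_mono X.cls (distClosure_comp_le X.cls ζ μ)

theorem cls_comp_cls {ζ : X.carrier ⟶ Y.carrier} (hζ : IsContinuous X.cls Y.cls ζ) {q : Q}
    (μ : Y.carrier ⟶ pt q) : X.cls.map (ζ ≫ (Y.cls.map μ : Y.carrier ⟶ pt q) : X.carrier ⟶ pt q) =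
      X.cls.map (ζ ≫ μ : X.carrier ⟶ pt q) := by
  refine le_antisymm (α := X.carrier ⟶ pt q) ?_
    (op_mono X.cls (comp_le_comp le_rfl (Y.le_map μ)))
  conv_rhs => rw [← X.map_map]
  exact op_mono X.cls (isContinuous_iff.1 hζ μ)

/-- At the closure of the representable of `y`, the functor induced by `ζ` returns the closure of
the column `ζ(-, y)`. Closedness of `η` is enough to compare the columns themselves. -/
theorem pullback_le_iff {ζ η : X.carrier ⟶ Y.carrier} (hζ : IsContinuous X.cls Y.cls ζ)
    (hη : IsContinuous X.cls Y.cls η) (hη' : IsClosedDist X.cls η) :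
    X.pullback ζ ≤ X.pullback η ↔ ζ ≤ η := by
  constructor
  · intro h
    refine dist_le_iff_col.2 fun {q} y => ?_
    have h₁ : (X.cls.map (ζ ≫ (Y.cls.map ((yoneda Y.carrier).map y) : Y.carrier ⟶ pt q) :
        X.carrier ⟶ pt q) : X.carrier ⟶ pt q) ≤ X.cls.map
          (η ≫ (Y.cls.map ((yoneda Y.carrier).map y) : Y.carrier ⟶ pt q) : X.carrier ⟶ pt q) :=
      psh_le_iff.1 (h q (Y.closed ((yoneda Y.carrier).map y)))
    rw [cls_comp_cls hζ, cls_comp_cls hη, ← col_eq_comp_yoneda, ← col_eq_comp_yoneda, hη'] at h₁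
    exact (X.le_map _).trans h₁
  · intro h q μ
    exact psh_le_iff.2 (op_mono X.cls (comp_le_comp h le_rfl))

/-- The distributor whose columns are the values of a functor at the closures of representables. -/
def ofFunctor (f : QFunctor (fixedPsh Y.cls) (fixedPsh X.cls)) : X.carrier ⟶ Y.carrier :=
  ofTranspose ((fixedPshIncl X.cls).comp (f.comp (Y.reflect.comp (yoneda Y.carrier))))

theorem col_ofFunctor (f : QFunctor (fixedPsh Y.cls) (fixedPsh X.cls)) {q : Q}
    (y : Y.carrier.obj q) :
    (col (ofFunctor f) y : X.carrier ⟶ pt q) =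
      (f.map (Y.closed ((yoneda Y.carrier).map y))).1 :=
  congrArg (fun F : QFunctor Y.carrier (Psh X.carrier) => F.map y) (transpose_ofTranspose _)

theorem isClosedDist_ofFunctor (f : QFunctor (fixedPsh Y.cls) (fixedPsh X.cls)) :
    IsClosedDist X.cls (ofFunctor f) := fun y => by
  have h := (f.map (Y.closed ((yoneda Y.carrier).map y))).2
  rwa [← col_ofFunctor] at h

/-- By Yoneda and `f ⊣ g`, the presheaf `μ ↙ ofFunctor f` is `g μ`: its value at `y` is the hom from
the closed representable of `y` to `g μ`. -/
theorem hom_ofFunctor_comp {f : QFunctor (fixedPsh Y.cls) (fixedPsh X.cls)}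
    {g : QFunctor (fixedPsh X.cls) (fixedPsh Y.cls)} (h : f.Adj g) {p q : Q}
    (ν : Y.carrier ⟶ pt p) (μ : (fixedPsh X.cls).obj q) :
    (Psh X.carrier).hom (ofFunctor f ≫ ν : X.carrier ⟶ pt p) μ.1 =
      (Psh Y.carrier).hom ν (g.map μ).1 := by
  rw [psh_hom_comp]
  congr 1
  refine ptDist_ext fun {r} y => ?_
  rw [← psh_hom_yoneda, ← psh_hom_yoneda, ← psh_hom_comp, ← col_eq_comp_yoneda, col_ofFunctor]
  exact (h _ μ).trans (Y.reflect_adj _ _)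

theorem psh_le_of_hom_le {X : QCat Q} {p : Q} {μ ν : X ⟶ pt p}
    (h : (Psh X).hom ν ν ≤ (Psh X).hom μ ν) : μ ≤ ν :=
  psh_le_iff.1 (((Psh X).id_le ν).trans h)

/-- Since `g μ` is closed, homs from `ofFunctor f ≫ ν` into a closed presheaf do not change when `ν`
is replaced by its closure. Testing against the closure of `ofFunctor f ≫ ν` gives continuity. -/
theorem isContinuous_ofFunctor {f : QFunctor (fixedPsh Y.cls) (fixedPsh X.cls)}
    (h : f.IsLeftAdj) : IsContinuous X.cls Y.cls (ofFunctor f) := by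
  obtain ⟨g, h⟩ := h
  refine isContinuous_iff.2 fun {q} ν => ?_
  refine psh_le_of_hom_le ?_
  rw [X.hom_cls _ (X.map_map _)]
  have h₁ := hom_ofFunctor_comp h (Y.cls.map ν) (X.closed (ofFunctor f ≫ ν : X.carrier ⟶ pt q))
  rw [Y.hom_cls ν (g.map _).2, ← hom_ofFunctor_comp h] at h₁
  exact h₁.ge

/-- Both functors are left adjoint to the same `g`; separatedness later turns the equality of homs
into fullness. -/
theorem hom_pullback_ofFunctor {f : QFunctor (fixedPsh Y.cls) (fixedPsh X.cls)}
    (h : f.IsLeftAdj) {p q : Q} (ν : (fixedPsh Y.cls).obj p) (μ : (fixedPsh X.cls).obj q) :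
    (fixedPsh X.cls).hom ((X.pullback (ofFunctor f)).map ν) μ =
      (fixedPsh X.cls).hom (f.map ν) μ := by
  obtain ⟨g, h⟩ := h
  rw [h]
  exact (X.reflect_adj _ μ).trans (hom_ofFunctor_comp h ν.1 μ)

end QClsDist

variable (Q) in
/-- The functor sending a closure space to its complete category of closed presheaves. -/
def closedPshFunctor : QClsCloDist Q ⥤ (QSup Q)ᵒᵖ where
  obj X := Opposite.op X.as.toSup
  map {X Y} ζ := (QClsDist.toSupMap ζ.1).op
  map_id X := congrArg Quiver.Hom.op (Subtype.ext (QFunctor.ext' fun {q} μ => Subtype.ext (by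
    change X.as.cls.map (distClosure X.as.cls (𝟙 X.as.carrier) ≫ μ.1 : X.as.carrier ⟶ pt q) = μ.1
    rw [QClsDist.cls_distClosure_comp, Category.id_comp, μ.2])))
  map_comp {X Y Z} ζ η := congrArg Quiver.Hom.op (Subtype.ext (QFunctor.ext' fun {q} μ =>
    Subtype.ext (by
      change X.as.cls.map
          (distClosure X.as.cls (ζ.1.1 ≫ η.1.1) ≫ μ.1 : X.as.carrier ⟶ pt q) =
        X.as.cls.map
          (ζ.1.1 ≫ (Y.as.cls.map (η.1.1 ≫ μ.1 : Y.as.carrier ⟶ pt q) : Y.as.carrier ⟶ pt q) :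
            X.as.carrier ⟶ pt q)
      rw [QClsDist.cls_distClosure_comp, QClsDist.cls_comp_cls ζ.1.2, Category.assoc])))

theorem closedPshFunctor_map_le_iff {X Y : QClsCloDist Q} {ζ η : X ⟶ Y} :
    (closedPshFunctor Q).map ζ ≤ (closedPshFunctor Q).map η ↔ ζ ≤ η :=
  QClsDist.pullback_le_iff ζ.1.2 η.1.2 (distClosure_eq_iff.1 (congrArg Subtype.val η.2))

theorem exists_closedPshFunctor_map {X Y : QClsCloDist Q}
    (f : (closedPshFunctor Q).obj X ⟶ (closedPshFunctor Q).obj Y) :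
    ∃ ζ, (closedPshFunctor Q).map ζ = f :=
  ⟨⟨⟨QClsDist.ofFunctor f.unop.1, QClsDist.isContinuous_ofFunctor f.unop.2⟩,
    Subtype.ext (distClosure_eq_iff.2 (QClsDist.isClosedDist_ofFunctor _))⟩,
    Quiver.Hom.unop_inj (sup_arrow_ext fun ν μ =>
      QClsDist.hom_pullback_ofFunctor f.unop.2 ν μ)⟩

/-- Every separated complete category is isomorphic to a category of closed presheaves. -/
theorem QSup.exists_iso (X : QSup Q) : ∃ Y : QClsDist Q, Nonempty (Y.toSup ≅ X) := by
  obtain ⟨A, hA, s, hs⟩ := X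
  have hsy : ∀ {q : Q} (x : A.obj q), s.map ((yoneda A).map x) = x := fun {q} x => by
    have h : ∀ {r : Q} (y : A.obj r), A.hom (s.map ((yoneda A).map x)) y = A.hom x y :=
      fun y => (hs _ y).trans (psh_hom_yoneda x _)
    exact hA _ _ ((A.id_le _).trans (h _).ge) ((A.id_le _).trans (h _).le)
  -- The fixed presheaves of `yoneda ∘ sup` are the representables, because `sup` retracts Yoneda by
  -- `hsy`.
  let Y : QClsDist Q :=
    { carrier := A
      cls := (yoneda A).comp s
      le_cls := fun q μ => (A.id_le _).trans (hs μ (s.map μ)).le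
      cls_cls := QFunctor.ext' fun μ => congrArg (yoneda A).map (hsy (s.map μ)) }
  have hf : ∀ {p q : Q} (μ : (fixedPsh Y.cls).obj p) (x : A.obj q),
      A.hom (s.map μ.1) x = (Psh A).hom μ.1 ((yoneda A).map x) := fun μ x => hs μ.1 x
  have hyy : ∀ {q : Q} (x : A.obj q), Y.cls.map ((yoneda A).map x) = (yoneda A).map x :=
    fun x => congrArg (yoneda A).map (hsy x)
  let f : QFunctor (fixedPsh Y.cls) A := s.comp (fixedPshIncl Y.cls)
  let g : QFunctor A (fixedPsh Y.cls) :=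
    ⟨fun x => ⟨(yoneda A).map x, hyy x⟩, fun x y => (yoneda A).hom_le x y⟩
  have hfg : f.Adj g := fun μ x => hf μ x
  -- Arrows of `Q-Sup` must be left adjoints, so the inverse needs its own right adjoint, namely
  -- `f`.
  have hgf : g.Adj f := fun {p q} x μ => by
    change (Psh A).hom ((yoneda A).map x) μ.1 = A.hom x (s.map μ.1)
    have h : μ.1 = (yoneda A).map (s.map μ.1) := μ.2.symm
    conv_lhs => rw [h]
    exact psh_hom_yoneda x _
  refine ⟨Y, ⟨⟨f, g, hfg⟩, ⟨g, f, hgf⟩, ?_, ?_⟩⟩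
  · exact Subtype.ext (QFunctor.ext' fun μ => Subtype.ext μ.2)
  · exact Subtype.ext (QFunctor.ext' fun x => hsy x)

variable (Q) in
theorem clsCloDist_equivalent_sup_op : QuantaloidEquivalent (QClsCloDist Q) (QSup Q)ᵒᵖ :=
  quantaloidEquivalent_of_map_le_map_iff (closedPshFunctor Q) closedPshFunctor_map_le_iff
    exists_closedPshFunctor_map ⟨fun X => by
      obtain ⟨Y, ⟨e⟩⟩ := X.unop.exists_iso
      exact ⟨⟨Y⟩, ⟨e.symm.op⟩⟩⟩

end Complete

end Quantaloids

theorem theorem8p5 (Q : Type u) [SmallCategory Q] [Quantaloid Q] (hQ : IsGirard Q) :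
    QuantaloidEquivalent (Diag (QDist Q)) (BackDiag (QDist Q)) ∧
    QuantaloidEquivalent (BackDiag (QDist Q)) (QIntDistO Q) ∧
    QuantaloidEquivalent (QIntDistO Q) (QClsCloDist Q) ∧
    QuantaloidEquivalent (QClsCloDist Q) (QSup Q)ᵒᵖ := by
  have h₁ := diag_equivalent_backDiag (isGirard_qdist hQ)
  have h₂ := diag_equivalent_intDistO Q
  have h₃ := backDiag_equivalent_clsCloDist Q
  -- The two middle links reach interior spaces through the diagonals, so both pass through `h₁`,
  -- the only place where the Girard structure enters.
  exact ⟨h₁, h₁.symm.trans h₂, (h₂.symm.trans h₁).trans h₃, clsCloDist_equivalent_sup_op Q⟩
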